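/- Let $n\ge 1$. Write $B_r=\{x\in\mathbb R^{n+1}:|x|\le r\}$ and $U_r=\{x\in\mathbb R^{n+1}:|x|<r\}$, let $\mathcal L^{n+1}$ be Lebesgue measure and $\mathcal H^n$ the $n$-dimensional Hausdorff measure on $\mathbb R^{n+1}$. A weight is a function $\Omega\in C^2(\mathbb R^{n+1})$ such that, for some constant $c_1\ge 0$, $0<\Omega\le 1$, $|\nabla\Omega|\le c_1\Omega$ and $\|\nabla^2\Omega\|\le c_1\Omega$ on $\mathbb R^{n+1}$. An $\Omega$-finite open partition of $N$ elements is an ordered family $\mathcal E=\{E_i\}_{i=1}^N$ of mutually disjoint open sets in $\mathbb R^{n+1}$ such that $\int_{\mathbb R^{n+1}\setminus\bigcup_i E_i}\Omega\,d\mathcal H^n<\infty$ and $\bigcup_i\partial E_i$ is countably $n$-rectifiable (covered, up to an $\mathcal H^n$-null set, by countably many Lipschitz images of $\mathbb R^n$). For any finite family $\mathcal E=\{E_i\}_{i=1}^N$ of open sets, $\|\partial\mathcal E\|$ denotes the restriction of $\mathcal H^n$ to $\bigcup_i\partial E_i$. For $f:\mathbb R^{n+1}\to\mathbb R^{n+1}$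 put $\tilde E_i=\operatorname{int} f(E_i)$ and $f_\star\mathcal E=\{\tilde E_i\}_{i=1}^N$. The map $f$ is $\mathcal E$-admissible if it is Lipschitz, the sets $\tilde E_i$ are mutually disjoint, $\mathbb R^{n+1}\setminus\bigcup_i\tilde E_i\subset f\big(\bigcup_i\partial E_i\big)$, and $\sup_x|f(x)-x|<\infty$. Then there exist constants $c_2,c_3\in(0,\infty)$ depending only on $n$ with the following property. Let $\Omega$ be a weight, $N\in\mathbb N$, $\mathcal E=\{E_i\}_{i=1}^N$ an $\Omega$-finite open partition and $R>0$, and suppose that $0\in\operatorname{spt}\|\partial\mathcal E\|$ and $\|\partial\mathcal E\|(B_R)\le c_2R^n$. Then there exist an $\mathcal E$-admissible function $f$ and $r\in[\frac R2,R]$ such that 1. $f(x)=x$ for all $x\in\mathbb R^{n+1}\setminus U_r$; 2. $f(x)\in B_r$ for all $x\in B_r$; 3. $\|\partial f_\star\mathcal E\|(B_r)\le\frac12\|\partial\mathcal E\|(B_r)$; 4. $\mathcal L^{n+1}(E_i\triangle\tilde E_i)\le c_3\,\big(\|\partial\mathcal E\|(B_r)\big)^{\frac{n+1}{n}}$ for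 all $i=1,\dots,N$. -/

import Mathlib

open MeasureTheory Set
open scoped ENNReal NNReal MeasureTheory

namespace OpenPartition

/-- Euclidean space `ℝ^m`. -/
abbrev Euc (m : ℕ) : Type := EuclideanSpace ℝ (Fin m)

/-- The `n`-dimensional Hausdorff measure on `ℝ^m` in the usual normalization, i.e. with the factor
`ω_n / 2^n`, where `ω_n` is the volume of the unit ball of `ℝ^n` (Mathlib's `μH[n]` is built from
`diam ^ n` without a factor). -/
noncomputable def hausdorff (n m : ℕ) : Measure (Euc m) :=
  (volume (Metric.ball (0 : Euc n) 1) / 2 ^ n) • μH[(n : ℝ)]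

/-- Countably `n`-rectifiable subsets of `ℝ^m`: up to an `ℋⁿ`-null set, covered by countably many
Lipschitz images of `ℝ^n`. -/
def IsCountablyRectifiable (n m : ℕ) (S : Set (Euc m)) : Prop :=
  ∃ g : ℕ → Euc n → Euc m, (∀ k, ∃ K : ℝ≥0, LipschitzWith K (g k)) ∧
    hausdorff n m (S \ ⋃ k, range (g k)) = 0

/-- Weight functions: `Ω ∈ C²` with `0 < Ω ≤ 1`, `|∇Ω| ≤ c₁ Ω` and `‖∇²Ω‖ ≤ c₁ Ω` for a
constant `c₁ ≥ 0`. -/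
def IsWeight {m : ℕ} (Ω : Euc m → ℝ) : Prop :=
  ContDiff ℝ 2 Ω ∧ (∀ x, 0 < Ω x ∧ Ω x ≤ 1) ∧
    ∃ c₁ : ℝ, 0 ≤ c₁ ∧ ∀ x, ‖fderiv ℝ Ω x‖ ≤ c₁ * Ω x ∧
      ‖fderiv ℝ (fderiv ℝ Ω) x‖ ≤ c₁ * Ω x

/-- `⋃ᵢ ∂Eᵢ`, the union of the topological boundaries. -/
def bdry {m N : ℕ} (E : Fin N → Set (Euc m)) : Set (Euc m) :=
  ⋃ i, frontier (E i)

/-- `E = {E₁, …, E_N}` is an `Ω`-finite open partition of `ℝ^{n+1}`. -/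
structure IsOpenPartition {n N : ℕ} (Ω : Euc (n + 1) → ℝ) (E : Fin N → Set (Euc (n + 1))) :
    Prop where
  isOpen : ∀ i, IsOpen (E i)
  disjoint : ∀ i j, i ≠ j → Disjoint (E i) (E j)
  finite : ((hausdorff n (n + 1)).withDensity fun x => ENNReal.ofReal (Ω x)) (⋃ i, E i)ᶜ < ∞
  rectifiable : IsCountablyRectifiable n (n + 1) (bdry E)

/-- The weight measure `‖∂E‖ = ℋⁿ⌊(⋃ᵢ ∂Eᵢ)` of the unit density varifold `|⋃ᵢ ∂Eᵢ|`. -/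
noncomputable def bdryMeasure {n N : ℕ} (E : Fin N → Set (Euc (n + 1))) : Measure (Euc (n + 1)) :=
  (hausdorff n (n + 1)).restrict (bdry E)

/-- The push-forward `f⋆E`, whose cells are the interiors of the sets `f(Eᵢ)`. -/
def push {m N : ℕ} (f : Euc m → Euc m) (E : Fin N → Set (Euc m)) : Fin N → Set (Euc m) :=
  fun i => interior (f '' E i)

/-- `E`-admissible functions. -/
structure IsAdmissible {m N : ℕ} (E : Fin N → Set (Euc m)) (f : Euc m → Euc m) : Prop where
  lipschitz : ∃ K : ℝ≥0, LipschitzWith K f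
  disjoint : ∀ i j, i ≠ j → Disjoint (push f E i) (push f E j)
  compl_subset : (⋃ i, push f E i)ᶜ ⊆ f '' bdry E
  displacement : ∃ C : ℝ, ∀ x, ‖f x - x‖ ≤ C

end OpenPartition

open OpenPartition

/-!
By the relative isoperimetric inequality, if `ℋⁿ (⋃ ∂Eᵢ)` is small in a ball then a single cell `E₀`
fills most of the ball, and the volume `v r` of `B_r \ E₀` is at most `C m ^ ((n + 1) / n)`, where
`m` is the measure of `⋃ ∂Eᵢ` in `B_r`. Slicing by spheres, `v' r = ℋⁿ (∂B_r \ E₀)`. If this were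
more than `m / 2` for every `r` in `[R / 2, R]`, then `v' ≥ c v ^ (n / (n + 1))`, and `v` would grow
beyond the bound that the smallness of `⋃ ∂Eᵢ` puts on it. For a radius `r` with
`ℋⁿ (∂B_r \ E₀) ≤ m / 2`, expand a small ball inside `E₀` radially, about its centre, onto all of
`B_r`. This pushes every other cell out of `B_r`, so that the boundaries left in `B_r` lie in
`∂B_r \ E₀`, and cells change only within `B_r \ E₀`.

The relative isoperimetric inequality holds because, if the union of the boundaries has small
projections onto the coordinate hyperplanes, then a random pair of points is, with probability close
to one, joined by an axis-parallel path that does not leave its cell.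
-/

namespace OpenPartition

open scoped Function Topology

/-! ### Disjoint families of open sets -/

section Topology

variable {X ι : Type*} [TopologicalSpace X] {E : ι → Set X}

lemma exists_subset_of_isPreconnected (hE : ∀ i, IsOpen (E i)) (hd : Pairwise (Disjoint on E))
    {s : Set X} (hs : IsPreconnected s) (hne : s.Nonempty) (hsE : s ⊆ ⋃ i, E i) :
    ∃ i, s ⊆ E i := by
  obtain ⟨x, hx⟩ := hne
  obtain ⟨i, hi⟩ := mem_iUnion.1 (hsE hx)
  refine ⟨i, hs.subset_left_of_subset_union (v := ⋃ j ∈ {j | j ≠ i}, E j) (hE i)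
    (isOpen_biUnion fun j _ => hE j) (disjoint_iUnion₂_right.2 fun j hj => hd (Ne.symm hj)) ?_
    ⟨x, hx, hi⟩⟩
  refine hsE.trans (iUnion_subset fun j => ?_)
  rcases eq_or_ne j i with rfl | hj
  · exact subset_union_left
  · exact subset_union_of_subset_right (subset_biUnion_of_mem (u := E) hj) _

lemma iUnion_frontier_subset_compl (hE : ∀ i, IsOpen (E i)) (hd : Pairwise (Disjoint on E)) :
    ⋃ i, frontier (E i) ⊆ (⋃ i, E i)ᶜ := by
  refine iUnion_subset fun i => subset_compl_comm.1 (iUnion_subset fun j => ?_)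
  rcases eq_or_ne i j with rfl | hij
  · exact fun x hx => by simp [(hE i).frontier_eq, hx]
  · exact fun x hx hfr => ((hd hij).closure_left (hE j)).le_bot
      ⟨frontier_subset_closure hfr, hx⟩

lemma iUnion_frontier_eq_compl [Finite ι] (hE : ∀ i, IsOpen (E i)) (hd : Pairwise (Disjoint on E))
    (hdense : Dense (⋃ i, E i)) : ⋃ i, frontier (E i) = (⋃ i, E i)ᶜ := by
  refine (iUnion_frontier_subset_compl hE hd).antisymm fun x hx => ?_
  have hx' : x ∈ ⋃ i, closure (E i) := closure_iUnion_of_finite (f := E) ▸ hdense x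
  obtain ⟨i, hi⟩ := mem_iUnion.1 hx'
  exact mem_iUnion.2 ⟨i, hi, fun h => hx (mem_iUnion.2 ⟨i, interior_subset h⟩)⟩

end Topology

/-! ### The relative isoperimetric inequality in a cube -/

section Product

variable {ι α : Type*} {n : ℕ}

/-- The points with the first `k` coordinates of `y` and the others of `x` join `x` to `y` along
axis-parallel lines. -/
lemma mem_of_forall_piecewise_notMem {E : ι → Set (Fin (n + 1) → α)}
    (hd : Pairwise (Disjoint on E)) {B : Fin (n + 1) → Set (Fin (n + 1) → α)}
    (hline : ∀ j, ∀ x ∉ B j, ∃ i, ∀ t, Function.update x j t ∈ E i) {x y : Fin (n + 1) → α}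
    (hB : ∀ j, (Iio j).piecewise y x ∉ B j) {i : ι} (hx : x ∈ E i) : y ∈ E i := by
  have hprefix (k : ℕ) (hk : k ≤ n + 1) : {j : Fin (n + 1) | j.val < k}.piecewise y x ∈ E i := by
    induction k with
    | zero =>
      convert hx using 1
      ext j
      simp [Set.piecewise]
    | succ k ih =>
      obtain ⟨i', hi'⟩ := hline ⟨k, hk⟩ _ (hB ⟨k, hk⟩)
      have hmem : (Iio (⟨k, hk⟩ : Fin (n + 1))).piecewise y x ∈ E i' := by
        convert hi' ((Iio (⟨k, hk⟩ : Fin (n + 1))).piecewise y x ⟨k, hk⟩) using 1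
        exact (Function.update_eq_self _ _).symm
      obtain rfl : i = i' := hd.eq (not_disjoint_iff.2 ⟨_, ih (by lia), hmem⟩)
      convert hi' (y ⟨k, hk⟩) using 1
      ext j
      rcases eq_or_ne j ⟨k, hk⟩ with rfl | hj
      · simp
      · have : j.val ≤ k ↔ j.val < k := by have := Fin.val_ne_of_ne hj; lia
        simp [hj, Set.piecewise, this, Fin.lt_def]
  convert hprefix (n + 1) le_rfl using 1
  ext j
  simp [Set.piecewise, j.is_le]

variable [MeasurableSpace α]

lemma measurePreserving_piecewise [Fintype ι] (μ : ι → Measure α) [∀ i, IsProbabilityMeasure (μ i)]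
    (s : Set ι) [DecidablePred (· ∈ s)] :
    MeasurePreserving (fun q : (ι → α) × (ι → α) => s.piecewise q.1 q.2)
      ((Measure.pi μ).prod (Measure.pi μ)) (Measure.pi μ) := by
  let g (i : ι) : α × α → α := if i ∈ s then Prod.fst else Prod.snd
  have hg (i : ι) : MeasurePreserving (g i) ((μ i).prod (μ i)) (μ i) := by
    by_cases hi : i ∈ s
    · simpa only [g, hi, if_true] using measurePreserving_fst
    · simpa only [g, hi, if_false] using measurePreserving_snd
  convert (measurePreserving_pi _ _ hg).comp
    (measurePreserving_arrowProdEquivProdArrow α α ι μ μ).symm using 1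
  ext q i
  by_cases hi : i ∈ s <;> simp [g, hi, MeasurableEquiv.arrowProdEquivProdArrow]

lemma one_le_sum_sq_add_sum [Fintype ι] {E : ι → Set (Fin (n + 1) → α)}
    (hd : Pairwise (Disjoint on E)) {B : Fin (n + 1) → Set (Fin (n + 1) → α)}
    (hB : ∀ j, MeasurableSet (B j))
    (hline : ∀ j, ∀ x ∉ B j, ∃ i, ∀ t, Function.update x j t ∈ E i)
    (μ : Fin (n + 1) → Measure α) [∀ j, IsProbabilityMeasure (μ j)] :
    1 ≤ ∑ i, Measure.pi μ (E i) * Measure.pi μ (E i) + ∑ j, Measure.pi μ (B j) := by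
  let mix (j : Fin (n + 1)) (q : (Fin (n + 1) → α) × (Fin (n + 1) → α)) : Fin (n + 1) → α :=
    (Iio j).piecewise q.1 q.2
  have hcover : univ ⊆ (⋃ i, E i ×ˢ E i) ∪ ⋃ j, mix j ⁻¹' B j := by
    rintro ⟨y, x⟩ -
    by_cases h : ∃ j, mix j (y, x) ∈ B j
    · exact Or.inr (mem_iUnion.2 h)
    push Not at h
    have hmix : mix 0 (y, x) = x := by
      ext j
      simp [mix]
    obtain ⟨i, hi⟩ := hline 0 x (hmix ▸ h 0)
    have hxi : x ∈ E i := by simpa using hi (x 0)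
    exact Or.inl (mem_iUnion.2 ⟨i, mem_of_forall_piecewise_notMem hd hline h hxi, hxi⟩)
  calc 1 = (Measure.pi μ).prod (Measure.pi μ) univ := measure_univ.symm
    _ ≤ (Measure.pi μ).prod (Measure.pi μ) (⋃ i, E i ×ˢ E i)
          + (Measure.pi μ).prod (Measure.pi μ) (⋃ j, mix j ⁻¹' B j) :=
        (measure_mono hcover).trans (measure_union_le _ _)
    _ ≤ _ := add_le_add ((measure_iUnion_fintype_le _ _).trans_eq ?_)
        ((measure_iUnion_fintype_le _ _).trans_eq ?_)
  · simp only [Measure.prod_prod]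
  · exact Finset.sum_congr rfl fun j _ =>
      (measurePreserving_piecewise μ (Iio j)).measure_preimage (hB j).nullMeasurableSet

/-- If almost no axis-parallel line leaves its cell, then resampling the coordinates of a random
point one at a time shows that two independent points are likely to share a cell. -/
lemma exists_measure_compl_le_sum [Finite ι] [Nonempty ι] {E : ι → Set (Fin (n + 1) → α)}
    (hE : ∀ i, MeasurableSet (E i)) (hd : Pairwise (Disjoint on E))
    {B : Fin (n + 1) → Set (Fin (n + 1) → α)} (hB : ∀ j, MeasurableSet (B j))
    (hline : ∀ j, ∀ x ∉ B j, ∃ i, ∀ t, Function.update x j t ∈ E i)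
    (μ : Fin (n + 1) → Measure α) [∀ j, IsProbabilityMeasure (μ j)] :
    ∃ i, Measure.pi μ (E i)ᶜ ≤ ∑ j, Measure.pi μ (B j) := by
  cases nonempty_fintype ι
  obtain ⟨i, hi⟩ := Finite.exists_max fun i => Measure.pi μ (E i)
  refine ⟨i, ?_⟩
  rw [prob_compl_eq_one_sub (hE i), tsub_le_iff_left]
  refine (one_le_sum_sq_add_sum hd hB hline μ).trans (add_le_add_left ?_ _)
  calc ∑ k, Measure.pi μ (E k) * Measure.pi μ (E k)
      ≤ ∑ k, Measure.pi μ (E i) * Measure.pi μ (E k) :=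
        Finset.sum_le_sum fun k _ => mul_le_mul_left (hi k) _
    _ = Measure.pi μ (E i) * Measure.pi μ (⋃ k, E k) := by
        rw [← Finset.mul_sum, measure_iUnion hd hE, tsum_fintype]
    _ ≤ Measure.pi μ (E i) := mul_le_of_le_one_right' prob_le_one

lemma measure_pow_le_of_update_mem (hn : 1 ≤ n) (μ : Fin (n + 1) → Measure α)
    [∀ j, IsProbabilityMeasure (μ j)] {D G : Set (Fin (n + 1) → α)} (hD : MeasurableSet D)
    (hG : MeasurableSet G) (h : ∀ x ∈ G, ∀ j t, Function.update x j t ∈ D) :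
    Measure.pi μ G ^ n ≤ Measure.pi μ D ^ (n + 1) := by
  have hn0 : (0 : ℝ) < n := by exact_mod_cast hn
  set p : ℝ := ((n : ℝ) + 1) / n with hp
  have hconj : Real.HolderConjugate (Fintype.card (Fin (n + 1))) p := by
    rw [Real.holderConjugate_iff, Fintype.card_fin, hp]
    push_cast
    refine ⟨by linarith, ?_⟩
    field_simp
    ring
  have hle : Measure.pi μ G ≤ Measure.pi μ D ^ p := by
    calc Measure.pi μ G
        ≤ ∫⁻ _ in G, 1 ∂Measure.pi μ := by simp
      _ ≤ ∫⁻ x in G, ∏ j, (∫⁻ t, D.indicator 1 (Function.update x j t) ∂μ j)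
            ^ ((1 : ℝ) / (Fintype.card (Fin (n + 1)) - 1 : ℝ)) ∂Measure.pi μ := by
          refine setLIntegral_mono' hG fun _ hx => (Finset.prod_eq_one fun j _ => ?_).ge
          simp [indicator_of_mem (h _ hx j _)]
      _ ≤ _ := setLIntegral_le_lintegral _ _
      _ ≤ _ := lintegral_prod_lintegral_pow_le μ hconj (measurable_one.indicator hD)
      _ = Measure.pi μ D ^ p := by rw [lintegral_indicator_one hD]
  calc Measure.pi μ G ^ n ≤ (Measure.pi μ D ^ p) ^ n := by gcongr
    _ = Measure.pi μ D ^ (n + 1) := by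
        rw [← ENNReal.rpow_natCast, ← ENNReal.rpow_mul, hp, div_mul_cancel₀ _ hn0.ne',
          ← ENNReal.rpow_natCast, Nat.cast_succ]

lemma exists_measure_compl_pow_le [Finite ι] [Nonempty ι] (hn : 1 ≤ n)
    {E : ι → Set (Fin (n + 1) → α)} (hE : ∀ i, MeasurableSet (E i)) (hd : Pairwise (Disjoint on E))
    {B : Fin (n + 1) → Set (Fin (n + 1) → α)} (hB : ∀ j, MeasurableSet (B j))
    (hline_mem : ∀ j, ∀ x ∈ B j, ∀ t, Function.update x j t ∈ B j)
    (hline : ∀ j, ∀ x ∉ B j, ∃ i, ∀ t, Function.update x j t ∈ E i)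
    (μ : Fin (n + 1) → Measure α) [∀ j, IsProbabilityMeasure (μ j)] :
    ∃ i, Measure.pi μ (E i)ᶜ ^ n ≤ (2 * ∑ j, Measure.pi μ (B j)) ^ (n + 1) := by
  obtain ⟨i, hi⟩ := exists_measure_compl_le_sum hE hd hB hline μ
  have hupdate (x) (hx : x ∈ (E i)ᶜ) (j t) : Function.update x j t ∈ (E i)ᶜ ∪ ⋃ j, B j := by
    by_cases hxj : x ∈ B j
    · exact Or.inr (mem_iUnion.2 ⟨j, hline_mem j x hxj t⟩)
    · obtain ⟨i', hi'⟩ := hline j x hxj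
      have hxi' : x ∈ E i' := Function.update_eq_self j x ▸ hi' (x j)
      have hne : i' ≠ i := fun h => hx (h ▸ hxi')
      exact Or.inl fun h => (hd hne).le_bot ⟨hi' t, h⟩
  refine ⟨i, (measure_pow_le_of_update_mem hn μ ((hE i).compl.union (.iUnion hB)) (hE i).compl
    hupdate).trans (pow_le_pow_left' ?_ _)⟩
  calc Measure.pi μ ((E i)ᶜ ∪ ⋃ j, B j)
      ≤ Measure.pi μ (E i)ᶜ + Measure.pi μ (⋃ j, B j) := measure_union_le _ _
    _ ≤ ∑ j, Measure.pi μ (B j) + ∑ j, Measure.pi μ (B j) :=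
        add_le_add hi (measure_iUnion_fintype_le _ _)
    _ = 2 * ∑ j, Measure.pi μ (B j) := (two_mul _).symm

end Product

section Cube

open unitInterval

lemma volume_pi_unitInterval_eq_hausdorffMeasure (ι : Type*) [Fintype ι] :
    (volume : Measure (ι → I)) = μH[Fintype.card ι] := by
  have hiso : Isometry fun (x : ι → I) i => (x i : ℝ) :=
    Isometry.piMap _ fun _ => isometry_subtype_coe
  have hmp : MeasurePreserving (fun (x : ι → I) i => (x i : ℝ)) volume
      (Measure.pi fun _ => volume.restrict (Icc 0 1)) :=
    measurePreserving_pi _ _ fun _ => measurePreserving_coe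
  have hemb : MeasurableEmbedding fun (x : ι → I) i => (x i : ℝ) :=
    hiso.isClosedEmbedding.measurableEmbedding
  ext s -
  calc volume s
    _ = Measure.pi (fun _ => volume.restrict (Icc 0 1)) ((fun x i => (x i : ℝ)) '' s) := by
        rw [← hmp.measure_preimage_emb hemb, preimage_image_eq s hemb.injective]
    _ = volume ((fun (x : ι → I) i => (x i : ℝ)) '' s) := by
        rw [← Measure.restrict_pi_pi, ← volume_pi, Measure.restrict_eq_self]
        rintro _ ⟨x, -, rfl⟩ i -
        exact (x i).2
    _ = μH[Fintype.card ι] s := by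
        rw [← hausdorffMeasure_pi_real, hiso.hausdorffMeasure_image (Or.inl (Nat.cast_nonneg _))]

lemma lipschitzWith_removeNth {α : Type*} [PseudoMetricSpace α] {n : ℕ} (j : Fin (n + 1)) :
    LipschitzWith 1 (fun x : Fin (n + 1) → α => j.removeNth x) :=
  LipschitzWith.of_dist_le_mul fun x y => by
    rw [NNReal.coe_one, one_mul, dist_pi_le_iff dist_nonneg]
    exact fun i => dist_le_pi_dist x y _

lemma volume_preimage_image_removeNth_le {n : ℕ} (j : Fin (n + 1)) {S : Set (Fin (n + 1) → I)}
    (hS : IsCompact S) : volume (j.removeNth ⁻¹' (j.removeNth '' S)) ≤ μH[n] S := by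
  have hmp : MeasurePreserving (fun x : Fin (n + 1) → I => j.removeNth x) volume volume :=
    measurePreserving_snd.comp (volume_preserving_piFinSuccAbove (fun _ => I) j)
  have hA : MeasurableSet (j.removeNth '' S) :=
    (hS.image (lipschitzWith_removeNth j).continuous).measurableSet
  calc volume (j.removeNth ⁻¹' (j.removeNth '' S)) = volume (j.removeNth '' S) :=
        hmp.measure_preimage hA.nullMeasurableSet
    _ = μH[n] (j.removeNth '' S) := by
        rw [volume_pi_unitInterval_eq_hausdorffMeasure, Fintype.card_fin]
    _ ≤ μH[n] S := by
        simpa using (lipschitzWith_removeNth j).hausdorffMeasure_image_le (Nat.cast_nonneg n) S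

end Cube

/-! ### The relative isoperimetric inequality in a ball -/

/-- The relative isoperimetric inequality for open partitions of `K`, with constant `C`: one of the
cells covers `K` up to a set controlled by the part of `K` in no cell. The exponents `1 / (n + 1)`
and `1 / n` of the two measures are cleared, and `μH` carries no normalizing factor. -/
def IsoperimetricOn {X : Type*} [EMetricSpace X] [MeasurableSpace X] [BorelSpace X] (n : ℕ)
    (C : ℝ≥0) (K : Set X) : Prop :=
  ∀ (ι : Type) [Finite ι] [Nonempty ι] (E : ι → Set X), (∀ i, IsOpen (E i)) →
    Pairwise (Disjoint on E) →
      ∃ i, μH[n + 1] (K \ E i) ^ n ≤ (C * μH[n] (K \ ⋃ i, E i)) ^ (n + 1)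

open unitInterval in
lemma isoperimetricOn_cube {n : ℕ} (hn : 1 ≤ n) :
    IsoperimetricOn n (2 * (n + 1)) (univ : Set (Fin (n + 1) → I)) := by
  intro ι _ _ E hE hd
  set S := (⋃ i, E i)ᶜ
  have hS : IsCompact S := (isOpen_iUnion hE).isClosed_compl.isCompact
  let B (j : Fin (n + 1)) : Set (Fin (n + 1) → I) := j.removeNth ⁻¹' (j.removeNth '' S)
  have hBm (j) : MeasurableSet (B j) :=
    have hcont := (lipschitzWith_removeNth j).continuous
    ((hS.image hcont).isClosed.preimage hcont).measurableSet
  have hB (j) : volume (B j) ≤ μH[n] S := volume_preimage_image_removeNth_le j hS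
  have hline (j) (x) (hx : x ∉ B j) : ∃ i, ∀ t, Function.update x j t ∈ E i := by
    have hsub : range (Function.update x j) ⊆ ⋃ i, E i := by
      rintro _ ⟨t, rfl⟩
      by_contra ht
      exact hx ⟨_, ht, Fin.removeNth_update j t x⟩
    obtain ⟨i, hi⟩ := exists_subset_of_isPreconnected hE hd
      (isPreconnected_range (by fun_prop)) (range_nonempty _) hsub
    exact ⟨i, fun t => hi (mem_range_self t)⟩
  have hline_mem (j) (x) (hx : x ∈ B j) (t) : Function.update x j t ∈ B j := by
    rwa [mem_preimage, Fin.removeNth_update]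
  obtain ⟨i, hi⟩ := exists_measure_compl_pow_le hn (fun i => (hE i).measurableSet) hd hBm
    hline_mem hline fun _ => volume
  refine ⟨i, ?_⟩
  have hvol : (volume : Measure (Fin (n + 1) → I)) = μH[n + 1] := by
    simpa using volume_pi_unitInterval_eq_hausdorffMeasure (Fin (n + 1))
  rw [← compl_eq_univ_sdiff, ← compl_eq_univ_sdiff, ← hvol]
  refine hi.trans (pow_le_pow_left' ?_ _)
  calc 2 * ∑ j, volume (B j) ≤ 2 * ∑ _j : Fin (n + 1), μH[n] S :=
        mul_le_mul_right (Finset.sum_le_sum fun j _ => hB j) _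
    _ = ↑(2 * (n + 1) : ℝ≥0) * μH[n] S := by
        simp only [Finset.sum_const, Finset.card_univ, Fintype.card_fin, nsmul_eq_mul]
        push_cast
        ring

section Isoperimetric

variable {X Y : Type*} [EMetricSpace X] [MeasurableSpace X] [BorelSpace X] [EMetricSpace Y]
  [MeasurableSpace Y] [BorelSpace Y] {n : ℕ} {C : ℝ≥0} {K : Set X}

lemma IsoperimetricOn.image (h : IsoperimetricOn n C K) {f : X → Y} {L L' : ℝ≥0}
    (hf : LipschitzWith L f) (hf' : AntilipschitzWith L' f) :
    IsoperimetricOn n (C * (L * L') ^ n) (f '' K) := by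
  intro ι _ _ E hE hd
  obtain ⟨i, hi⟩ := h ι (fun i => f ⁻¹' E i) (fun i => (hE i).preimage hf.continuous)
    fun i j hij => (hd hij).preimage f
  have hlip : μH[n + 1] (f '' K \ E i) ≤ L ^ (n + 1) * μH[n + 1] (K \ f ⁻¹' E i) := by
    rw [← image_sdiff_preimage]
    exact_mod_cast hf.hausdorffMeasure_image_le (by positivity : (0 : ℝ) ≤ n + 1) _
  have hanti : μH[n] (K \ ⋃ i, f ⁻¹' E i) ≤ L' ^ n * μH[n] (f '' K \ ⋃ i, E i) := by
    rw [← preimage_iUnion, ← image_sdiff_preimage]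
    exact_mod_cast hf'.le_hausdorffMeasure_image n.cast_nonneg _
  refine ⟨i, ?_⟩
  calc μH[n + 1] (f '' K \ E i) ^ n
      ≤ (L ^ (n + 1) * μH[n + 1] (K \ f ⁻¹' E i)) ^ n := by gcongr
    _ ≤ (L ^ (n + 1)) ^ n * (C * μH[n] (K \ ⋃ i, f ⁻¹' E i)) ^ (n + 1) := by
        rw [mul_pow]
        gcongr
    _ ≤ (L ^ (n + 1)) ^ n * (C * (L' ^ n * μH[n] (f '' K \ ⋃ i, E i))) ^ (n + 1) := by gcongr
    _ = (↑(C * (L * L') ^ n) * μH[n] (f '' K \ ⋃ i, E i)) ^ (n + 1) := by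
        push_cast
        ring

lemma IsoperimetricOn.measure_sdiff_pow_le (h : IsoperimetricOn n C K) {ι : Type} [Finite ι]
    {E : ι → Set X} (hE : ∀ i, IsOpen (E i)) (hd : Pairwise (Disjoint on E)) {j : ι}
    (hj : μH[n + 1] (K \ E j) ≤ μH[n + 1] (K ∩ E j)) :
    μH[n + 1] (K \ E j) ^ n ≤ (C * μH[n] (K \ ⋃ i, E i)) ^ (n + 1) := by
  have : Nonempty ι := ⟨j⟩
  obtain ⟨i, hi⟩ := h ι E hE hd
  rcases eq_or_ne i j with rfl | hij
  · exact hi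
  · refine (pow_le_pow_left' (hj.trans (measure_mono ?_)) n).trans hi
    exact fun x hx => ⟨hx.1, fun hxi => (hd hij).le_bot ⟨hxi, hx.2⟩⟩

end Isoperimetric

section Gauge

variable {V : Type*} [NormedAddCommGroup V] [NormedSpace ℝ V]

lemma lipschitzWith_smul_self {φ : V → ℝ} {M L : ℝ≥0} (hM : ∀ x, |φ x| ≤ M)
    (hL : ∀ x y, |φ x - φ y| * ‖y‖ ≤ L * ‖x - y‖) : LipschitzWith (M + L) fun x => φ x • x := by
  refine LipschitzWith.of_dist_le_mul fun x y => ?_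
  calc dist (φ x • x) (φ y • y) = ‖φ x • (x - y) + (φ x - φ y) • y‖ := by
        rw [dist_eq_norm]
        congr 1
        module
    _ ≤ |φ x| * ‖x - y‖ + |φ x - φ y| * ‖y‖ := by
        simpa only [norm_smul, Real.norm_eq_abs] using
          norm_add_le (φ x • (x - y)) ((φ x - φ y) • y)
    _ ≤ M * ‖x - y‖ + L * ‖x - y‖ :=
        add_le_add (mul_le_mul_of_nonneg_right (hM x) (norm_nonneg _)) (hL x y)
    _ = ↑(M + L) * dist x y := by
        rw [dist_eq_norm]
        push_cast
        ring

variable {s t : Set V}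

lemma exists_norm_le_mul_gauge (ht : Bornology.IsBounded t) (ht₀ : t ∈ 𝓝 0) :
    ∃ r : ℝ≥0, ∀ x, ‖x‖ ≤ r * gauge t x := by
  obtain ⟨r, hr, htr⟩ := ht.subset_closedBall_lt 0 0
  refine ⟨⟨r, hr.le⟩, fun x => ?_⟩
  have := le_gauge_of_subset_closedBall (absorbent_nhds_zero ht₀) hr.le htr (x := x)
  rwa [div_le_iff₀' hr] at this

lemma exists_gauge_le_mul_norm (hs : Convex ℝ s) (hs₀ : s ∈ 𝓝 0) :
    ∃ L : ℝ≥0, LipschitzWith L (gauge s) ∧ ∀ x, gauge s x ≤ L * ‖x‖ := by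
  obtain ⟨L, hL⟩ := hs.lipschitz_gauge hs₀
  refine ⟨L, hL, fun x => ?_⟩
  simpa [abs_of_nonneg (gauge_nonneg x)] using hL.dist_le_mul x 0

lemma abs_div_sub_div_mul_le {a b a' b' : ℝ} (hb' : 0 < b') (h : b = 0 → a = 0) :
    |a / b - a' / b'| * b' ≤ |a - a'| + |a / b| * |b - b'| := by
  have hab : a / b * b = a := div_mul_cancel_of_imp h
  calc |a / b - a' / b'| * b' = |(a - a') - a / b * (b - b')| := by
        rw [← abs_of_pos hb', ← abs_mul, sub_mul, abs_of_pos hb', div_mul_cancel₀ _ hb'.ne']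
        congr 1
        linear_combination hab
    _ ≤ |a - a'| + |a / b| * |b - b'| := (abs_sub _ _).trans_eq (by rw [abs_mul])

lemma exists_lipschitzWith_gaugeRescale (hs : Convex ℝ s) (hs₀ : s ∈ 𝓝 0) (ht : Convex ℝ t)
    (ht₀ : t ∈ 𝓝 0) (htb : Bornology.IsBounded t) : ∃ L, LipschitzWith L (gaugeRescale s t) := by
  obtain ⟨r, hr⟩ := exists_norm_le_mul_gauge htb ht₀
  obtain ⟨L, hL, hLs⟩ := exists_gauge_le_mul_norm hs hs₀
  obtain ⟨M, hM⟩ := ht.lipschitz_gauge ht₀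
  have habs (x : V) : |gauge s x / gauge t x| ≤ L * r := by
    rw [abs_of_nonneg (div_nonneg (gauge_nonneg x) (gauge_nonneg x))]
    refine div_le_of_le_mul₀ (gauge_nonneg x) (by positivity) ((hLs x).trans ?_)
    rw [mul_assoc]
    gcongr
    exact hr x
  refine ⟨L * r + (L + L * r * M) * r, lipschitzWith_smul_self (mod_cast habs) fun x y => ?_⟩
  rcases eq_or_ne y 0 with rfl | hy
  · simpa using by positivity
  have hpos (z : V) (hz : z ≠ 0) : 0 < gauge t z :=
    pos_of_mul_pos_right ((norm_pos_iff.2 hz).trans_le (hr z)) r.2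
  have hs' : |gauge s x - gauge s y| ≤ L * ‖x - y‖ := by
    simpa [Real.dist_eq, dist_eq_norm] using hL.dist_le_mul x y
  have ht' : |gauge t x - gauge t y| ≤ M * ‖x - y‖ := by
    simpa [Real.dist_eq, dist_eq_norm] using hM.dist_le_mul x y
  have h₀ : gauge t x = 0 → gauge s x = 0 := fun hx => by
    obtain rfl : x = 0 := by_contra fun h => (hpos x h).ne' hx
    exact gauge_zero
  calc |gauge s x / gauge t x - gauge s y / gauge t y| * ‖y‖
      ≤ |gauge s x / gauge t x - gauge s y / gauge t y| * (r * gauge t y) := by gcongr; exact hr y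
    _ = |gauge s x / gauge t x - gauge s y / gauge t y| * gauge t y * r := by ring
    _ ≤ (|gauge s x - gauge s y| + |gauge s x / gauge t x| * |gauge t x - gauge t y|) * r := by
        gcongr
        exact abs_div_sub_div_mul_le (hpos y hy) h₀
    _ ≤ (L * ‖x - y‖ + L * r * (M * ‖x - y‖)) * r := by gcongr; exact habs x
    _ = ↑((L + L * r * M) * r) * ‖x - y‖ := by
        push_cast
        ring

lemma exists_bilipschitz_image_eq (hs : Convex ℝ s) (hs₀ : s ∈ 𝓝 0)
    (hsb : Bornology.IsBounded s) (hsc : IsClosed s) (ht : Convex ℝ t) (ht₀ : t ∈ 𝓝 0)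
    (htb : Bornology.IsBounded t) (htc : IsClosed t) :
    ∃ (f : V → V) (L L' : ℝ≥0), LipschitzWith L f ∧ AntilipschitzWith L' f ∧ f '' s = t := by
  have hsv := (NormedSpace.isVonNBounded_iff ℝ).2 hsb
  have htv := (NormedSpace.isVonNBounded_iff ℝ).2 htb
  obtain ⟨L, hL⟩ := exists_lipschitzWith_gaugeRescale hs hs₀ ht ht₀ htb
  obtain ⟨L', hL'⟩ := exists_lipschitzWith_gaugeRescale ht ht₀ hs hs₀ hsb
  have hinv (x : V) : gaugeRescale t s (gaugeRescale s t x) = x := by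
    rw [gaugeRescale_gaugeRescale (absorbent_nhds_zero ht₀) htv,
      gaugeRescale_self_apply (absorbent_nhds_zero hs₀) hsv]
  refine ⟨gaugeRescale s t, L, L', hL, fun x y => ?_, ?_⟩
  · simpa only [hinv] using hL' (gaugeRescale s t x) (gaugeRescale s t y)
  · have := image_gaugeRescaleHomeomorph_closure hs hs₀ hsv ht ht₀ htv
    rwa [hsc.closure_eq, htc.closure_eq] at this

lemma lipschitzWith_const_smul (r : ℝ) : LipschitzWith ‖r‖₊ fun x : V => r • x :=
  fun x y => (edist_smul₀ r x y).le

lemma antilipschitzWith_const_smul {r : ℝ} (hr : r ≠ 0) :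
    AntilipschitzWith ‖r‖₊⁻¹ fun x : V => r • x := fun x y => by
  simpa [smul_smul, hr] using lipschitzWith_const_smul r⁻¹ (r • x) (r • y)

end Gauge

section Ball

open unitInterval

variable {n : ℕ}

lemma image_unitInterval_eq_closedBall (n : ℕ) :
    (fun (x : Fin n → I) i => 2 * (x i : ℝ) - 1) '' univ = Metric.closedBall 0 1 := by
  ext y
  simp only [image_univ, mem_range, mem_closedBall_zero_iff, pi_norm_le_iff_of_nonneg zero_le_one,
    Real.norm_eq_abs, abs_le]
  constructor
  · rintro ⟨x, rfl⟩ i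
    exact ⟨by linarith [(x i).2.1], by linarith [(x i).2.2]⟩
  · intro h
    refine ⟨fun i => ⟨(y i + 1) / 2, by linarith [(h i).1], by linarith [(h i).2]⟩, ?_⟩
    ext i
    change 2 * ((y i + 1) / 2) - 1 = y i
    ring

variable {V : Type*} [NormedAddCommGroup V] [NormedSpace ℝ V] [MeasurableSpace V] [BorelSpace V]

lemma exists_isoperimetricOn_closedBall_one (hn : 1 ≤ n) (hV : Module.finrank ℝ V = n + 1) :
    ∃ C, IsoperimetricOn n C (Metric.closedBall (0 : V) 1) := by
  have : FiniteDimensional ℝ V := .of_finrank_pos (by lia)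
  let T : (Fin (n + 1) → ℝ) ≃L[ℝ] V := .ofFinrankEq (by simp [hV])
  let f (x : Fin (n + 1) → I) (i : Fin (n + 1)) : ℝ := 2 * (x i : ℝ) - 1
  have hdist (x y : Fin (n + 1) → I) (i) : dist (f x i) (f y i) = 2 * dist (x i) (y i) := by
    simp [f, Subtype.dist_eq, Real.dist_eq, ← mul_sub, abs_mul]
  have hf : LipschitzWith 2 f := .of_dist_le_mul fun x y =>
    (dist_pi_le_iff (by positivity)).2 fun i => by
      rw [hdist]
      exact mul_le_mul_of_nonneg_left (dist_le_pi_dist x y i) zero_le_two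
  have hf' : AntilipschitzWith 1 f := .of_le_mul_dist fun x y => by
    rw [NNReal.coe_one, one_mul, dist_pi_le_iff dist_nonneg]
    intro i
    linarith [hdist x y i, dist_le_pi_dist (f x) (f y) i, @dist_nonneg _ _ (x i) (y i)]
  have hcube := (isoperimetricOn_cube hn).image hf hf'
  rw [image_unitInterval_eq_closedBall] at hcube
  have hT := hcube.image T.lipschitz T.antilipschitz
  obtain ⟨g, L, L', hg, hg', himage⟩ := exists_bilipschitz_image_eq
    ((convex_closedBall 0 1).linear_image T.toLinearMap)
    (map_zero T ▸ T.toHomeomorph.isOpenMap.image_mem_nhds (Metric.closedBall_mem_nhds 0 one_pos))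
    (T.lipschitz.isBounded_image Metric.isBounded_closedBall)
    (T.toHomeomorph.isClosedMap _ Metric.isClosed_closedBall) (convex_closedBall (0 : V) 1)
    (Metric.closedBall_mem_nhds _ one_pos) Metric.isBounded_closedBall Metric.isClosed_closedBall
  exact ⟨_, himage ▸ hT.image hg hg'⟩

lemma exists_isoperimetricOn_closedBall (hn : 1 ≤ n) (hV : Module.finrank ℝ V = n + 1) :
    ∃ C, ∀ r : ℝ, 0 < r → IsoperimetricOn n C (Metric.closedBall (0 : V) r) := by
  obtain ⟨C, hC⟩ := exists_isoperimetricOn_closedBall_one (V := V) hn hV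
  refine ⟨C, fun r hr => ?_⟩
  have hr' : ‖r‖₊ ≠ 0 := by simpa using hr.ne'
  have h := hC.image (lipschitzWith_const_smul r) (antilipschitzWith_const_smul hr.ne')
  rw [mul_inv_cancel₀ hr', one_pow, mul_one, image_smul, smul_unitClosedBall_of_nonneg hr.le] at h
  exact h

end Ball

/-! ### Slicing by spheres -/

section Slicing

open Filter

lemma volume_toMeasurable_image_le {X : Type*} [EMetricSpace X] {g : X → ℝ} {L : ℝ≥0}
    (hg : LipschitzWith L g) (U : Set X) :
    volume (toMeasurable volume (g '' U)) ≤ L * Metric.ediam U := by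
  rw [measure_toMeasurable]
  exact (Real.volume_le_diam _).trans (hg.ediam_image_le U)

variable {X : Type*} [EMetricSpace X] [MeasurableSpace X] [BorelSpace X]

lemma exists_cover_tsum_ediam_rpow_le {d : ℝ} (hd : 0 < d) {A : Set X} (hA : μH[d] A ≠ ∞)
    {δ : ℝ≥0∞} (hδ : 0 < δ) :
    ∃ U : ℕ → Set X, A ⊆ ⋃ i, U i ∧ (∀ i, Metric.ediam (U i) ≤ δ) ∧
      ∑' i, Metric.ediam (U i) ^ d ≤ μH[d] A + δ := by
  have hlt : (⨅ (U : ℕ → Set X) (_ : A ⊆ ⋃ i, U i) (_ : ∀ i, Metric.ediam (U i) ≤ δ),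
      ∑' i, ⨆ _ : (U i).Nonempty, Metric.ediam (U i) ^ d) < μH[d] A + δ := by
    refine lt_of_le_of_lt ?_ (ENNReal.lt_add_right hA hδ.ne')
    rw [Measure.hausdorffMeasure_apply]
    exact le_iSup₂_of_le δ hδ le_rfl
  simp only [iInf_lt_iff] at hlt
  obtain ⟨U, hU, hdiam, hsum⟩ := hlt
  refine ⟨U, hU, hdiam, (ENNReal.tsum_le_tsum fun i => ?_).trans hsum.le⟩
  rcases (U i).eq_empty_or_nonempty with h | h
  · simp [h, hd]
  · simp only [h, iSup_pos, le_refl]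

/-- Eilenberg's inequality, for the upper integral: the measures of the level sets need not depend
measurably on `t`. -/
theorem exists_measurable_hausdorffMeasure_level_le {d : ℝ} (hd : 0 < d) {g : X → ℝ} {L : ℝ≥0}
    (hg : LipschitzWith L g) {A : Set X} (hA : μH[d + 1] A ≠ ∞) :
    ∃ h : ℝ → ℝ≥0∞, Measurable h ∧ (∀ t, μH[d] (A ∩ g ⁻¹' {t}) ≤ h t) ∧
      ∫⁻ t, h t ≤ L * μH[d + 1] A := by
  let δ (k : ℕ) : ℝ≥0∞ := ((k : ℝ≥0∞) + 1)⁻¹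
  have hδ (k) : 0 < δ k := by simp [δ]
  have hlim : Tendsto δ atTop (𝓝 0) := by
    simpa using (tendsto_add_atTop_iff_nat 1).2 ENNReal.tendsto_inv_nat_nhds_zero
  choose U hUA hUd hUs using fun k => exists_cover_tsum_ediam_rpow_le (by linarith) hA (hδ k)
  let I (k i : ℕ) : Set ℝ := toMeasurable volume (g '' U k i)
  let F (k i : ℕ) : ℝ → ℝ≥0∞ := (I k i).indicator fun _ => Metric.ediam (U k i) ^ d
  have hF (k i) : Measurable (F k i) := measurable_const.indicator (measurableSet_toMeasurable _ _)
  have hslice (t : ℝ) : μH[d] (A ∩ g ⁻¹' {t}) ≤ liminf (fun k => ∑' i, F k i t) atTop := by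
    refine (Measure.hausdorffMeasure_le_liminf_tsum d _ δ hlim (fun k i => U k i ∩ g ⁻¹' {t})
      (.of_forall fun k i => (Metric.ediam_mono inter_subset_left).trans (hUd k i))
      (.of_forall fun k => ?_)).trans
      (liminf_le_liminf (.of_forall fun k => ENNReal.tsum_le_tsum fun i => ?_))
    · exact iUnion_inter _ _ ▸ inter_subset_inter_left _ (hUA k)
    · rcases (U k i ∩ g ⁻¹' {t}).eq_empty_or_nonempty with h | ⟨x, hx⟩
      · simp [h, hd]
      · have ht : t ∈ I k i := subset_toMeasurable _ _ ⟨x, hx⟩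
        simp only [F, indicator_of_mem ht]
        exact ENNReal.rpow_le_rpow (Metric.ediam_mono inter_subset_left) hd.le
  have hint (k i) : ∫⁻ t, F k i t ≤ L * Metric.ediam (U k i) ^ (d + 1) := by
    rw [lintegral_indicator_const (measurableSet_toMeasurable _ _),
      ENNReal.rpow_add_of_nonneg _ _ hd.le zero_le_one, ENNReal.rpow_one, mul_left_comm]
    gcongr
    exact volume_toMeasurable_image_le hg _
  refine ⟨_, Measurable.liminf fun k => Measurable.tsum (hF k), hslice, ?_⟩
  calc ∫⁻ t, liminf (fun k => ∑' i, F k i t) atTop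
      ≤ liminf (fun k => ∫⁻ t, ∑' i, F k i t) atTop :=
        lintegral_liminf_le fun k => Measurable.tsum (hF k)
    _ ≤ liminf (fun k => L * (μH[d + 1] A + δ k)) atTop := by
        refine liminf_le_liminf (.of_forall fun k => ?_)
        rw [lintegral_tsum fun i => (hF k i).aemeasurable]
        refine (ENNReal.tsum_le_tsum (hint k)).trans ?_
        rw [ENNReal.tsum_mul_left]
        gcongr
        exact hUs k
    _ = L * μH[d + 1] A := by
        have := ENNReal.Tendsto.const_mul (tendsto_const_nhds.add hlim)
          (Or.inr ENNReal.coe_ne_top) (a := L) (b := μH[d + 1] A + 0)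
        rw [this.liminf_eq, add_zero]

lemma exists_sub_mul_hausdorffMeasure_sphere_sdiff_le {V : Type*} [NormedAddCommGroup V]
    [MeasurableSpace V] [BorelSpace V] {d : ℝ} (hd : 0 < d) (F : Set V) {s t : ℝ} (hst : s < t) :
    ∃ u ∈ Ioc s t, ENNReal.ofReal (t - s) * μH[d] (Metric.sphere 0 u \ F) ≤
      μH[d + 1] (Metric.closedBall (0 : V) t \ F) := by
  rcases eq_or_ne (μH[d + 1] (Metric.closedBall (0 : V) t \ F)) ∞ with htop | htop
  · exact ⟨t, ⟨hst, le_rfl⟩, htop ▸ le_top⟩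
  obtain ⟨h, hmeas, hslice, hint⟩ :=
    exists_measurable_hausdorffMeasure_level_le hd lipschitzWith_one_norm htop
  have hvol : volume (Ioc s t) = ENNReal.ofReal (t - s) := Real.volume_Ioc
  have hvol₀ : volume (Ioc s t) ≠ 0 := by simp [hvol, hst]
  obtain ⟨u, hu, hle⟩ :=
    exists_le_setLAverage hvol₀ measure_Ioc_lt_top.ne hmeas.aemeasurable.restrict
  have hsub : Metric.sphere 0 u \ F ⊆ (Metric.closedBall (0 : V) t \ F) ∩ norm ⁻¹' {u} :=
    fun x hx => ⟨⟨Metric.closedBall_subset_closedBall hu.2 (Metric.sphere_subset_closedBall hx.1),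
      hx.2⟩, mem_sphere_zero_iff_norm.1 hx.1⟩
  refine ⟨u, hu, ?_⟩
  calc ENNReal.ofReal (t - s) * μH[d] (Metric.sphere 0 u \ F)
      ≤ volume (Ioc s t) * ⨍⁻ x in Ioc s t, h x ∂volume := by
        rw [hvol]
        gcongr
        exact ((measure_mono hsub).trans (hslice u)).trans hle
    _ = ∫⁻ x in Ioc s t, h x := measure_mul_setLAverage _ measure_Ioc_lt_top.ne
    _ ≤ ∫⁻ x, h x := setLIntegral_le_lintegral _ _
    _ ≤ μH[d + 1] (Metric.closedBall (0 : V) t \ F) := by simpa using hint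

end Slicing

/-! ### Radii with small slices -/

section RadiusSelection

open Filter

lemma le_pow_of_le_two_mul_pow {n : ℕ} {x y : ℝ≥0∞} {ℓ : ℝ} {b K : ℝ≥0} (hb : 0 < b)
    (hℓ : 2 ^ (n + 1) * K * b < ℓ)
    (hgrowth : (b : ℝ≥0∞) ^ (n + 1) < x → ENNReal.ofReal ℓ * b ^ n ≤ K * y)
    (hy : y ≤ (2 * b) ^ (n + 1)) : x ≤ b ^ (n + 1) := by
  by_contra! hlt
  have hmul : ENNReal.ofReal ℓ * b ^ n ≤ (2 ^ (n + 1) * K * b : ℝ≥0) * (b : ℝ≥0∞) ^ n :=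
    calc ENNReal.ofReal ℓ * b ^ n ≤ K * (2 * b) ^ (n + 1) := (hgrowth hlt).trans (by gcongr)
      _ = (2 ^ (n + 1) * K * b : ℝ≥0) * (b : ℝ≥0∞) ^ n := by push_cast; ring
  have hcancel : ENNReal.ofReal ℓ ≤ (2 ^ (n + 1) * K * b : ℝ≥0) :=
    (ENNReal.mul_le_mul_iff_left (by simp [hb.ne']) (by simp)).1 hmul
  rw [← ENNReal.ofReal_coe_nnreal, ENNReal.ofReal_le_ofReal_iff NNReal.zero_le_coe] at hcancel
  exact hℓ.not_ge (by exact_mod_cast hcancel)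

/-- A discrete form of the differential inequality `v ^ (n / (n + 1)) ≤ K v'`, whose solutions
vanish once their root `v ^ (1 / (n + 1))` has decreased at a definite rate for long enough. -/
lemma eq_zero_of_pow_lt_imp_mul_pow_le {n : ℕ} {v : ℝ → ℝ≥0∞} (hv : Monotone v) {α β : ℝ}
    {a K : ℝ≥0} (ha : 0 < a) (hαβ : 2 ^ (n + 1) * K * a < β - α)
    (hgrowth : ∀ s t, α ≤ s → s < t → t ≤ β → ∀ b : ℝ≥0, (b : ℝ≥0∞) ^ (n + 1) < v s →
      ENNReal.ofReal (t - s) * b ^ n ≤ K * v t)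
    (hβ : v β ≤ a ^ (n + 1)) : v α = 0 := by
  have hℓ : 0 < β - α := lt_of_le_of_lt (by positivity) hαβ
  have hhalf (k : ℕ) : v (α + (β - α) / 2 ^ k) ≤ ((a / 2 ^ k : ℝ≥0) : ℝ≥0∞) ^ (n + 1) := by
    induction k with
    | zero => simpa using hβ
    | succ k ih =>
      have hstep : (β - α) / 2 ^ k = 2 * ((β - α) / 2 ^ (k + 1)) := by rw [pow_succ]; field_simp
      have hle : (β - α) / 2 ^ k ≤ β - α := div_le_self hℓ.le (one_le_pow₀ one_le_two)
      have hpos : 0 < (β - α) / 2 ^ (k + 1) := by positivity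
      refine le_pow_of_le_two_mul_pow (ℓ := (β - α) / 2 ^ (k + 1)) (K := K) (by positivity) ?_
        (fun hlt => ?_) (ih.trans_eq ?_)
      · push_cast
        rw [← mul_div_assoc]
        gcongr
      · convert hgrowth _ (α + (β - α) / 2 ^ k) (by linarith) (by linarith) (by linarith) _ hlt
          using 3
        linarith
      · rw [show a / 2 ^ k = 2 * (a / 2 ^ (k + 1)) by rw [pow_succ]; field_simp]
        push_cast
        rfl
  have hlim : Tendsto (fun k : ℕ => ((a / 2 ^ k : ℝ≥0) : ℝ≥0∞) ^ (n + 1)) atTop (𝓝 0) := by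
    have h := ((NNReal.tendsto_pow_atTop_nhds_zero_of_lt_one
      (show (2⁻¹ : ℝ≥0) < 1 by norm_num)).const_mul a).pow (n + 1)
    simpa [div_eq_mul_inv] using ENNReal.tendsto_coe.2 h
  exact nonpos_iff_eq_zero.1
    (ge_of_tendsto' hlim fun k => (hv (le_add_of_nonneg_right (by positivity))).trans (hhalf k))

variable {V : Type*} [NormedAddCommGroup V] [MeasurableSpace V] [BorelSpace V]

lemma exists_hausdorffMeasure_sphere_sdiff_le_half {n : ℕ} (hn : 0 < n) {F : Set V} {R : ℝ}
    (hR : 0 < R) {m : ℝ → ℝ≥0∞} (hm : Monotone m) {C a : ℝ≥0} (ha : 0 < a)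
    (haR : 2 ^ (n + 4) * C * a < R)
    (hiso : ∀ r ∈ Icc (R / 2) R,
      μH[n + 1] (Metric.closedBall 0 r \ F) ^ n ≤ (C * m r) ^ (n + 1))
    (hsmall : μH[n + 1] (Metric.closedBall 0 R \ F) ≤ a ^ (n + 1)) :
    ∃ r ∈ Icc (R / 2) R, μH[n] (Metric.sphere 0 r \ F) ≤ m r / 2 := by
  by_contra! hlarge
  let v (r : ℝ) : ℝ≥0∞ := μH[n + 1] (Metric.closedBall 0 r \ F)
  have hv : Monotone v := fun s t hst => measure_mono (by gcongr)
  have hslice (s t) (hs : R / 2 ≤ s) (hst : s < t) (ht : t ≤ R) :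
      ENNReal.ofReal (t - s) * (m s / 2) ≤ v t := by
    obtain ⟨u, hu, hle⟩ :=
      exists_sub_mul_hausdorffMeasure_sphere_sdiff_le (Nat.cast_pos.2 hn) F hst
    refine le_trans ?_ hle
    gcongr
    exact (ENNReal.div_le_div_right (hm hu.1.le) 2).trans
      (hlarge u ⟨hs.trans hu.1.le, hu.2.trans ht⟩).le
  have hzero : v (3 * R / 4) = 0 := by
    refine eq_zero_of_pow_lt_imp_mul_pow_le (K := 2 * C) hv ha ?_
      (fun s t hs hst ht b hb => ?_) hsmall
    · rw [pow_add] at haR ⊢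
      push_cast
      linarith
    have hbm : (b : ℝ≥0∞) ^ n ≤ C * m s := by
      refine (ENNReal.pow_le_pow_left_iff n.succ_ne_zero).1 ?_
      rw [← pow_mul, mul_comm, pow_mul]
      exact (pow_le_pow_left₀ zero_le hb.le n).trans (hiso s ⟨by linarith, by linarith⟩)
    calc ENNReal.ofReal (t - s) * b ^ n ≤ ENNReal.ofReal (t - s) * (C * m s) := by gcongr
      _ = C * (ENNReal.ofReal (t - s) * (2 * (m s / 2))) := by
          rw [ENNReal.mul_div_cancel two_ne_zero ENNReal.ofNat_ne_top, mul_left_comm]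
      _ = (2 * C : ℝ≥0) * (ENNReal.ofReal (t - s) * (m s / 2)) := by push_cast; ring
      _ ≤ (2 * C : ℝ≥0) * v t := by gcongr; exact hslice s t (by linarith) hst ht
  obtain ⟨u, hu, hle⟩ := exists_sub_mul_hausdorffMeasure_sphere_sdiff_le (Nat.cast_pos.2 hn) F
    (show R / 2 < 3 * R / 4 by linarith)
  have hpos : 0 < ENNReal.ofReal (3 * R / 4 - R / 2) := ENNReal.ofReal_pos.2 (by linarith)
  have hnull : μH[n] (Metric.sphere 0 u \ F) = 0 := by
    simpa [hpos.ne'] using hle.trans_eq hzero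
  exact not_lt_zero (hnull ▸ hlarge u ⟨hu.1.le, by linarith [hu.2]⟩)

end RadiusSelection

/-! ### The dominant cell -/

section DominantCell

open Filter

lemma measure_sdiff_le_measure_inter {X : Type*} [MeasurableSpace X] {μ : Measure X} {s t : Set X}
    (ht : MeasurableSet t) (hs : μ s ≠ ∞) (h : 2 * μ (s \ t) ≤ μ s) : μ (s \ t) ≤ μ (s ∩ t) := by
  rw [← measure_inter_add_sdiff s ht, two_mul] at h
  exact (ENNReal.add_le_add_iff_right (measure_ne_top_of_subset sdiff_subset hs)).1 h

lemma exists_pos_mul_lt_one_and_mul_pow_lt (n : ℕ) (A : ℝ≥0) {B : ℝ≥0∞} (hB : 0 < B) :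
    ∃ γ : ℝ≥0, 0 < γ ∧ A * γ < 1 ∧ 2 ^ (n + 2) * (γ : ℝ≥0∞) ^ (n + 1) < B := by
  have h₁ : ∀ᶠ γ : ℝ≥0 in 𝓝[>] 0, A * γ < 1 :=
    ((continuous_const_mul A).tendsto' 0 0 (mul_zero A)).eventually_lt_const zero_lt_one
      |>.filter_mono nhdsWithin_le_nhds
  have h₂ : ∀ᶠ γ : ℝ≥0 in 𝓝[>] 0, 2 ^ (n + 2) * (γ : ℝ≥0∞) ^ (n + 1) < B := by
    have hcont : Continuous fun γ : ℝ≥0 => ((2 ^ (n + 2) * γ ^ (n + 1) : ℝ≥0) : ℝ≥0∞) := by fun_prop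
    refine (hcont.tendsto' 0 0 (by simp)).eventually_lt_const hB
      |>.filter_mono nhdsWithin_le_nhds |>.mono fun γ h => by exact_mod_cast h
  obtain ⟨γ, hγ, h⟩ := ((h₁.and h₂).and self_mem_nhdsWithin).exists
  exact ⟨γ, h, hγ⟩

lemma ball_inter_nonempty_of_measure_sdiff_le {V : Type*} [NormedAddCommGroup V]
    [NormedSpace ℝ V] [MeasurableSpace V] {μ : Measure V} {F : Set V} (hF : IsOpen F) {r : ℝ}
    (hr : r ≠ 0) (hball : μ (Metric.closedBall 0 r) ≠ 0)
    (h : μ (Metric.closedBall 0 r \ F) ≤ μ (Metric.closedBall 0 r ∩ F)) :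
    (Metric.ball 0 r ∩ F).Nonempty := by
  have hpos : μ (Metric.closedBall 0 r ∩ F) ≠ 0 := by
    intro h₀
    refine hball (measure_mono_null (inter_union_sdiff _ F).ge (measure_union_null h₀ ?_))
    exact nonpos_iff_eq_zero.1 (h₀ ▸ h)
  obtain ⟨x, hx, hxF⟩ := nonempty_of_measure_ne_zero hpos
  rw [← closure_ball _ hr] at hx
  rw [inter_comm]
  exact mem_closure_iff.1 hx F hF hxF

lemma le_mul_pow_of_pow_le {n : ℕ} (hn : n ≠ 0) {C γ : ℝ≥0} {v m ρ : ℝ≥0∞}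
    (hm : m ≤ (γ ^ n / (C + 1) : ℝ≥0) * ρ ^ n) (hv : v ^ n ≤ (C * m) ^ (n + 1)) :
    v ≤ (γ * ρ) ^ (n + 1) := by
  have hγC : C * (γ ^ n / (C + 1)) ≤ γ ^ n := by
    rw [mul_div_left_comm]
    exact mul_le_of_le_one_right zero_le (div_le_one_of_le₀ (by simp) zero_le)
  have hCm : C * m ≤ (γ * ρ) ^ n :=
    calc C * m ≤ C * ((γ ^ n / (C + 1) : ℝ≥0) * ρ ^ n) := by gcongr
      _ = (C * (γ ^ n / (C + 1)) : ℝ≥0) * ρ ^ n := by push_cast; ring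
      _ ≤ γ ^ n * ρ ^ n := by gcongr; exact_mod_cast hγC
      _ = (γ * ρ) ^ n := (mul_pow _ _ _).symm
  refine (ENNReal.pow_le_pow_left_iff hn).1 (hv.trans ?_)
  rw [← pow_mul, mul_comm (n + 1), pow_mul]
  gcongr

variable {n : ℕ} {V : Type*} [NormedAddCommGroup V] [NormedSpace ℝ V] [MeasurableSpace V]
  [BorelSpace V]

lemma isAddHaarMeasure_hausdorffMeasure_add_one (hV : Module.finrank ℝ V = n + 1) :
    (μH[(n : ℝ) + 1] : Measure V).IsAddHaarMeasure := by
  have : FiniteDimensional ℝ V := .of_finrank_pos (by lia)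
  have h := isAddHaarMeasure_hausdorffMeasure (E := V)
  rwa [hV, Nat.cast_add_one] at h

lemma two_mul_measure_sdiff_le_closedBall (hV : Module.finrank ℝ V = n + 1) {F : Set V} {R r : ℝ}
    (hr : r ∈ Icc (R / 2) R) (hR : 0 < R) {γ : ℝ≥0}
    (hγ : 2 ^ (n + 2) * (γ : ℝ≥0∞) ^ (n + 1) ≤ μH[n + 1] (Metric.closedBall (0 : V) 1))
    (hF : μH[n + 1] (Metric.closedBall 0 R \ F) ≤ (γ * ENNReal.ofReal R) ^ (n + 1)) :
    2 * μH[n + 1] (Metric.closedBall 0 r \ F) ≤ μH[n + 1] (Metric.closedBall (0 : V) r) := by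
  have : FiniteDimensional ℝ V := .of_finrank_pos (by lia)
  have := isAddHaarMeasure_hausdorffMeasure_add_one hV
  have hr₀ : 0 ≤ r := by linarith [hr.1]
  have hR' : ENNReal.ofReal R ≤ 2 * ENNReal.ofReal r := by
    rw [← ENNReal.ofReal_ofNat, ← ENNReal.ofReal_mul zero_le_two]
    exact ENNReal.ofReal_le_ofReal (by linarith [hr.1])
  calc 2 * μH[n + 1] (Metric.closedBall 0 r \ F)
      ≤ 2 * (γ * (2 * ENNReal.ofReal r)) ^ (n + 1) := by
        gcongr
        refine (measure_mono ?_).trans (hF.trans (by gcongr))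
        exact sdiff_subset_sdiff_left (Metric.closedBall_subset_closedBall hr.2)
    _ = ENNReal.ofReal r ^ (n + 1) * (2 ^ (n + 2) * γ ^ (n + 1)) := by ring
    _ ≤ ENNReal.ofReal r ^ (n + 1) * μH[n + 1] (Metric.closedBall (0 : V) 1) := by gcongr
    _ = μH[n + 1] (Metric.closedBall (0 : V) r) := by
        rw [Measure.addHaar_closedBall' μH[(n : ℝ) + 1] 0 hr₀, hV, ENNReal.ofReal_pow hr₀]

theorem exists_dominant_cell (hn : 1 ≤ n) (hV : Module.finrank ℝ V = n + 1) :
    ∃ c C : ℝ≥0, 0 < c ∧ ∀ (ι : Type) [Finite ι] [Nonempty ι] (E : ι → Set V),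
      (∀ i, IsOpen (E i)) → Pairwise (Disjoint on E) → ∀ R : ℝ, 0 < R →
      μH[n] (Metric.closedBall 0 R \ ⋃ i, E i) ≤ c * ENNReal.ofReal R ^ n →
      ∃ i, ∃ r ∈ Icc (R / 2) R, (Metric.ball 0 r ∩ E i).Nonempty ∧
        μH[n] (Metric.sphere 0 r \ E i) ≤ μH[n] (Metric.closedBall 0 r \ ⋃ i, E i) / 2 ∧
        μH[n + 1] (Metric.closedBall 0 r \ E i) ^ n ≤
          (C * μH[n] (Metric.closedBall 0 r \ ⋃ i, E i)) ^ (n + 1) := by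
  have : FiniteDimensional ℝ V := .of_finrank_pos (by lia)
  have := isAddHaarMeasure_hausdorffMeasure_add_one hV
  obtain ⟨C, hC⟩ := exists_isoperimetricOn_closedBall hn hV
  obtain ⟨γ, hγ, hCγ, hγV⟩ := exists_pos_mul_lt_one_and_mul_pow_lt n (2 ^ (n + 4) * C)
    (Metric.measure_closedBall_pos μH[(n : ℝ) + 1] (0 : V) one_pos)
  refine ⟨γ ^ n / (C + 1), C, by positivity, fun ι _ _ E hE hd R hR hm => ?_⟩
  obtain ⟨i, hi⟩ := hC R hR ι E hE hd
  have hsmall : μH[n + 1] (Metric.closedBall 0 R \ E i) ≤ (γ * ENNReal.ofReal R) ^ (n + 1) :=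
    le_mul_pow_of_pow_le (by lia) hm hi
  have hmajority (r) (hr : r ∈ Icc (R / 2) R) :
      μH[n + 1] (Metric.closedBall 0 r \ E i) ≤ μH[n + 1] (Metric.closedBall 0 r ∩ E i) :=
    measure_sdiff_le_measure_inter (hE i).measurableSet measure_closedBall_lt_top.ne
      (two_mul_measure_sdiff_le_closedBall hV hr hR hγV.le hsmall)
  have hpos (r) (hr : r ∈ Icc (R / 2) R) : 0 < r := by linarith [hr.1]
  have hiso (r) (hr : r ∈ Icc (R / 2) R) :=
    (hC r (hpos r hr)).measure_sdiff_pow_le hE hd (hmajority r hr)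
  have hγR : 2 ^ (n + 4) * C * (γ * R.toNNReal : ℝ≥0) < R := by
    have : (2 ^ (n + 4) * C * γ : ℝ) < 1 := by exact_mod_cast hCγ
    simpa [Real.coe_toNNReal _ hR.le, mul_assoc] using mul_lt_mul_of_pos_right this hR
  obtain ⟨r, hr, hslice⟩ := exists_hausdorffMeasure_sphere_sdiff_le_half (by lia) hR
    (m := fun r => μH[n] (Metric.closedBall 0 r \ ⋃ i, E i))
    (fun s t hst => measure_mono (by gcongr)) (mul_pos hγ (by simpa)) hγR hiso
    (by simpa [ENNReal.ofReal] using hsmall)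
  exact ⟨i, r, hr, ball_inter_nonempty_of_measure_sdiff_le (hE i) (hpos r hr).ne'
    (Metric.measure_closedBall_pos _ _ (hpos r hr)).ne' (hmajority r hr), hslice, hiso r hr⟩

end DominantCell

/-! ### Engulfing maps -/

section Engulfing

variable {X Y : Type*} [TopologicalSpace X] [TopologicalSpace Y] {f : X → X} {A B K U : Set X}

/-- A map supported in `K` which engulfs the interior of `K` by the image of `U`: applied to a
family of disjoint sets one of which is `U`, it pushes all the other sets out of the interior of
`K`. -/
structure IsEngulfing (f : X → X) (K U : Set X) : Prop where
  eqOn_id : EqOn f id (interior K)ᶜ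
  mapsTo : MapsTo f K K
  interior_subset_image : interior K ⊆ f '' U
  disjoint_image_compl : Disjoint (interior K) (f '' Uᶜ)
  frontier_sdiff_subset_image : frontier K \ U ⊆ f '' frontier U

namespace IsEngulfing

lemma conj (h : IsEngulfing f K U) (e : X ≃ₜ Y) :
    IsEngulfing (e ∘ f ∘ e.symm) (e '' K) (e '' U) := by
  have himage (A : Set X) : (e ∘ f ∘ e.symm) '' (e '' A) = e '' (f '' A) := by
    simp [image_image]
  constructor
  · intro y hy
    obtain ⟨x, rfl⟩ := e.surjective y
    rw [← e.image_interior, ← image_compl_eq e.bijective, e.injective.mem_set_image] at hy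
    simp [h.eqOn_id hy]
  · rintro _ ⟨x, hx, rfl⟩
    simpa using h.mapsTo hx
  · rw [himage, ← e.image_interior]
    exact image_mono h.interior_subset_image
  · rw [← image_compl_eq e.bijective, himage, ← e.image_interior]
    exact disjoint_image_of_injective e.injective h.disjoint_image_compl
  · rw [← e.image_frontier, ← e.image_frontier, himage, ← image_sdiff e.injective]
    exact image_mono h.frontier_sdiff_subset_image

lemma image_sdiff_subset (h : IsEngulfing f K U) (A : Set X) : f '' A \ K ⊆ A := by
  rintro _ ⟨⟨x, hx, rfl⟩, hfx⟩
  have hxK : x ∈ (interior K)ᶜ := fun hxK => hfx (h.mapsTo (interior_subset hxK))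
  rwa [h.eqOn_id hxK]

lemma sdiff_interior_subset_image (h : IsEngulfing f K U) (A : Set X) : A \ interior K ⊆ f '' A :=
  fun x hx => ⟨x, hx.1, h.eqOn_id hx.2⟩

lemma sdiff_subset_interior_image (h : IsEngulfing f K U) (hK : IsClosed K) (hA : IsOpen A) :
    A \ K ⊆ interior (f '' A) :=
  interior_maximal ((sdiff_subset_sdiff_right interior_subset).trans
    (h.sdiff_interior_subset_image A)) (hA.sdiff hK)

lemma union_subset_interior_image (h : IsEngulfing f K U) (hU : IsOpen U) :
    interior K ∪ U ⊆ interior (f '' U) := by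
  refine interior_maximal ?_ (isOpen_interior.union hU)
  rw [← union_sdiff_self]
  exact union_subset h.interior_subset_image (h.sdiff_interior_subset_image U)

lemma interior_image_subset_sdiff (h : IsEngulfing f K U) (hK : K ⊆ closure (interior K))
    (hAU : Disjoint A U) : interior (f '' A) ⊆ A \ K := by
  have hdisj : Disjoint (interior (f '' A)) (interior K) :=
    (h.disjoint_image_compl.mono_right (image_mono hAU.subset_compl_right)).symm.mono_left
      interior_subset
  have hnotMem {x} (hx : x ∈ interior (f '' A)) : x ∉ K := fun hxK =>
    (hdisj.closure_right isOpen_interior).notMem_of_mem_left hx (hK hxK)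
  exact fun x hx => ⟨h.image_sdiff_subset A ⟨interior_subset hx, hnotMem hx⟩, hnotMem hx⟩

lemma disjoint_interior_image (h : IsEngulfing f K U) (hK : K ⊆ closure (interior K))
    (hAU : Disjoint A U) : Disjoint (interior (f '' A)) (interior (f '' U)) :=
  disjoint_left.2 fun _ hxA hxU =>
    have hx := h.interior_image_subset_sdiff hK hAU hxA
    hAU.notMem_of_mem_left hx.1 (h.image_sdiff_subset U ⟨interior_subset hxU, hx.2⟩)

section Family

variable {ι : Type*} {E : ι → Set X} {i₀ : ι}

lemma pairwise_disjoint_interior_image (h : IsEngulfing f K (E i₀)) (hK : K ⊆ closure (interior K))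
    (hd : Pairwise (Disjoint on E)) : Pairwise (Disjoint on fun i => interior (f '' E i)) := by
  intro i j hij
  rcases eq_or_ne i i₀ with rfl | hi
  · exact (h.disjoint_interior_image hK (hd hij.symm)).symm
  rcases eq_or_ne j i₀ with rfl | hj
  · exact h.disjoint_interior_image hK (hd hij)
  · exact (hd hij).mono ((h.interior_image_subset_sdiff hK (hd hi)).trans sdiff_subset)
      ((h.interior_image_subset_sdiff hK (hd hj)).trans sdiff_subset)

lemma compl_iUnion_interior_image_subset (h : IsEngulfing f K (E i₀)) (hK : IsClosed K)
    (hE : ∀ i, IsOpen (E i)) (hcompl : (⋃ i, E i)ᶜ ⊆ ⋃ i, frontier (E i)) :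
    (⋃ i, interior (f '' E i))ᶜ ⊆ f '' ⋃ i, frontier (E i) := by
  simp only [compl_iUnion]
  intro y hy
  have hyU : y ∉ interior K ∪ E i₀ := fun hyU =>
    mem_iInter.1 hy i₀ (h.union_subset_interior_image (hE i₀) hyU)
  by_cases hyK : y ∈ K
  · have hyf : y ∈ frontier K \ E i₀ := ⟨⟨subset_closure hyK, mt .inl hyU⟩, mt .inr hyU⟩
    exact image_mono (subset_iUnion _ i₀) (h.frontier_sdiff_subset_image hyf)
  · refine ⟨y, hcompl ?_, h.eqOn_id (mt .inl hyU)⟩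
    simp only [mem_compl_iff, mem_iUnion, not_exists]
    exact fun i hi => mem_iInter.1 hy i (h.sdiff_subset_interior_image hK (hE i) ⟨hi, hyK⟩)

lemma iUnion_frontier_interior_image_inter_subset (h : IsEngulfing f K (E i₀))
    (hK : K ⊆ closure (interior K)) (hE : ∀ i, IsOpen (E i)) (hd : Pairwise (Disjoint on E)) :
    (⋃ i, frontier (interior (f '' E i))) ∩ K ⊆ frontier K \ E i₀ := by
  rintro x ⟨hx, hxK⟩
  have hxU : x ∉ interior K ∪ E i₀ := fun hxU =>
    iUnion_frontier_subset_compl (fun _ => isOpen_interior)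
      (h.pairwise_disjoint_interior_image hK hd) hx
      (mem_iUnion_of_mem i₀ (h.union_subset_interior_image (hE i₀) hxU))
  exact ⟨⟨subset_closure hxK, mt .inl hxU⟩, mt .inr hxU⟩

lemma symmDiff_interior_image_subset (h : IsEngulfing f K (E i₀)) (hKc : IsClosed K)
    (hK : K ⊆ closure (interior K)) (hE : ∀ i, IsOpen (E i)) (hd : Pairwise (Disjoint on E))
    (i : ι) : symmDiff (E i) (interior (f '' E i)) ⊆ K \ E i₀ := by
  rcases eq_or_ne i i₀ with rfl | hi
  · rintro x (⟨hx, hx'⟩ | ⟨hx, hx'⟩)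
    · exact absurd (h.union_subset_interior_image (hE i) (.inr hx)) hx'
    · exact ⟨by_contra fun hxK => hx' (h.image_sdiff_subset _ ⟨interior_subset hx, hxK⟩), hx'⟩
  · rintro x (⟨hx, hx'⟩ | ⟨hx, hx'⟩)
    · exact ⟨by_contra fun hxK => hx' (h.sdiff_subset_interior_image hKc (hE i) ⟨hx, hxK⟩),
        (hd hi).notMem_of_mem_left hx⟩
    · exact absurd (h.interior_image_subset_sdiff hK (hd hi) hx).1 hx'

end Family

end IsEngulfing

end Engulfing

section Expansion

open Filter

lemma inter_frontier_nonempty_of_isPreconnected {X : Type*} [TopologicalSpace X] {s u : Set X}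
    (hs : IsPreconnected s) (h : (s ∩ u).Nonempty) (h' : (s \ u).Nonempty) :
    (s ∩ frontier u).Nonempty := by
  by_contra hempty
  have hcover : s ⊆ interior u ∪ (closure u)ᶜ := fun y hy =>
    or_iff_not_imp_left.2 fun hyi hyc => hempty ⟨y, hy, hyc, hyi⟩
  obtain ⟨x, hx, hxu⟩ := h
  obtain ⟨y, hy, hyu⟩ := h'
  obtain ⟨z, -, hz, hz'⟩ := hs _ _ isOpen_interior isClosed_closure.isOpen_compl hcover
    ⟨x, hx, (hcover hx).resolve_right fun hxc => hxc (subset_closure hxu)⟩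
    ⟨y, hy, (hcover hy).resolve_left fun hyi => hyu (interior_subset hyi)⟩
  exact hz' (interior_subset_closure hz)

variable {V : Type*} [NormedAddCommGroup V] [NormedSpace ℝ V] {K U : Set V} {δ : ℝ} {x y : V}

/-- The retraction onto a convex body `K` around `0` which moves the points outside `K` towards `0`
along rays. -/
noncomputable def radialRetraction (K : Set V) (x : V) : V := (max 1 (gauge K x))⁻¹ • x

lemma gauge_radialRetraction (K : Set V) (x : V) :
    gauge K (radialRetraction K x) = (max 1 (gauge K x))⁻¹ * gauge K x :=
  gauge_smul_of_nonneg (by positivity) x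

lemma radialRetraction_of_gauge_le_one (hx : gauge K x ≤ 1) : radialRetraction K x = x := by
  simp [radialRetraction, hx]

lemma radialRetraction_mem (hK : Convex ℝ K) (hK₀ : K ∈ 𝓝 0) (hKc : IsClosed K) (x : V) :
    radialRetraction K x ∈ K := by
  have hgauge : gauge K (radialRetraction K x) ≤ 1 := by
    rw [gauge_radialRetraction]
    exact inv_mul_le_one_of_le₀ (le_max_right _ _) (by positivity)
  exact hKc.closure_subset ((gauge_le_one_iff_mem_closure hK hK₀).1 hgauge)

lemma radialRetraction_mem_frontier (hK : Convex ℝ K) (hK₀ : K ∈ 𝓝 0) (hx : 1 ≤ gauge K x) :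
    radialRetraction K x ∈ frontier K := by
  rw [← gauge_eq_one_iff_mem_frontier hK hK₀, gauge_radialRetraction, max_eq_right hx,
    inv_mul_cancel₀ (by positivity)]

lemma radialRetraction_smul {c : ℝ} (hc : 1 ≤ c) (hx : 1 ≤ gauge K x) :
    radialRetraction K (c • x) = radialRetraction K x := by
  have hc₀ : 0 < c := by positivity
  rw [radialRetraction, radialRetraction, gauge_smul_of_nonneg hc₀.le, smul_eq_mul,
    max_eq_right (one_le_mul_of_one_le_of_one_le hc hx), max_eq_right hx, smul_smul, mul_inv,
    mul_right_comm, inv_mul_cancel₀ hc₀.ne', one_mul]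

lemma exists_lipschitzWith_radialRetraction (hK : Convex ℝ K) (hK₀ : K ∈ 𝓝 0)
    (hKb : Bornology.IsBounded K) : ∃ L, LipschitzWith L (radialRetraction K) := by
  obtain ⟨r, hr⟩ := exists_norm_le_mul_gauge hKb hK₀
  obtain ⟨L, hL⟩ := hK.lipschitz_gauge hK₀
  let ρ (x : V) : ℝ := max 1 (gauge K x)
  have hρ (x : V) : 0 < ρ x := lt_max_of_lt_left one_pos
  have hρL (x y : V) : |ρ x - ρ y| ≤ L * ‖x - y‖ := by
    simpa [ρ, Real.dist_eq, dist_eq_norm] using (hL.const_max 1).dist_le_mul x y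
  have habs (x : V) : |1 / ρ x| ≤ 1 := by
    rw [abs_of_pos (one_div_pos.2 (hρ x))]
    exact (div_le_one (hρ x)).2 (le_max_left _ _)
  suffices h : ∀ x y, |1 / ρ x - 1 / ρ y| * ‖y‖ ≤ ↑(L * r) * ‖x - y‖ by
    have hlip := lipschitzWith_smul_self (M := 1) habs h
    simp only [one_div] at hlip
    exact ⟨_, hlip⟩
  intro x y
  calc |1 / ρ x - 1 / ρ y| * ‖y‖ ≤ |1 / ρ x - 1 / ρ y| * (r * ρ y) := by
        gcongr
        exact (hr y).trans (by gcongr; exact le_max_right _ _)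
    _ = |1 / ρ x - 1 / ρ y| * ρ y * r := by ring
    _ ≤ (|(1 : ℝ) - 1| + |1 / ρ x| * |ρ x - ρ y|) * r := by
        gcongr
        exact abs_div_sub_div_mul_le (hρ y) fun h => absurd h (hρ x).ne'
    _ ≤ (0 + 1 * (L * ‖x - y‖)) * r := by
        gcongr
        · simp
        · exact habs x
        · exact hρL x y
    _ = ↑(L * r) * ‖x - y‖ := by push_cast; ring

/-- The homothety of ratio `δ⁻¹` on `δ • K`, continued to the rest of `K` along rays onto the
frontier of `K`, and by the identity outside `K`. -/
noncomputable def expansion (K : Set V) (δ : ℝ) (x : V) : V :=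
  x + (radialRetraction K (δ⁻¹ • x) - radialRetraction K x)

lemma expansion_of_gauge_le_one (hx : gauge K x ≤ 1) :
    expansion K δ x = radialRetraction K (δ⁻¹ • x) := by
  rw [expansion, radialRetraction_of_gauge_le_one hx, add_sub_cancel]

lemma expansion_of_one_le_gauge (hδ : 0 < δ) (hδ₁ : δ ≤ 1) (hx : 1 ≤ gauge K x) :
    expansion K δ x = x := by
  rw [expansion, radialRetraction_smul (one_le_inv₀ hδ |>.2 hδ₁) hx, sub_self, add_zero]

lemma exists_lipschitzWith_expansion (hK : Convex ℝ K) (hK₀ : K ∈ 𝓝 0)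
    (hKb : Bornology.IsBounded K) (δ : ℝ) : ∃ L, LipschitzWith L (expansion K δ) := by
  obtain ⟨L, hL⟩ := exists_lipschitzWith_radialRetraction hK hK₀ hKb
  exact ⟨_, LipschitzWith.id.add ((hL.comp (lipschitzWith_const_smul δ⁻¹)).sub hL)⟩

lemma norm_expansion_sub_le (hK : Convex ℝ K) (hK₀ : K ∈ 𝓝 0) (hKb : Bornology.IsBounded K)
    (hKc : IsClosed K) (δ : ℝ) (x : V) : ‖expansion K δ x - x‖ ≤ Metric.diam K := by
  rw [expansion, add_sub_cancel_left, ← dist_eq_norm]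
  exact Metric.dist_le_diam_of_mem hKb (radialRetraction_mem hK hK₀ hKc _)
    (radialRetraction_mem hK hK₀ hKc _)

lemma expansion_smul_of_mem_frontier (hK : Convex ℝ K) (hK₀ : K ∈ 𝓝 0) (hδ : 0 < δ)
    (hy : y ∈ frontier K) {t : ℝ} (ht : t ∈ Icc δ 1) : expansion K δ (t • y) = y := by
  have hy₁ : gauge K y = 1 := (gauge_eq_one_iff_mem_frontier hK hK₀).2 hy
  have ht₁ : gauge K (t • y) ≤ 1 := by
    rw [gauge_smul_of_nonneg (hδ.le.trans ht.1), hy₁, smul_eq_mul, mul_one]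
    exact ht.2
  rw [expansion_of_gauge_le_one ht₁, smul_smul,
    radialRetraction_smul ((one_le_inv_mul₀ hδ).2 ht.1) hy₁.ge,
    radialRetraction_of_gauge_le_one hy₁.le]

lemma isEngulfing_expansion (hK : Convex ℝ K) (hK₀ : K ∈ 𝓝 0) (hKc : IsClosed K) (hδ : 0 < δ)
    (hδ₁ : δ ≤ 1) (hU : MapsTo (δ • ·) K U) : IsEngulfing (expansion K δ) K U where
  eqOn_id x hx := expansion_of_one_le_gauge hδ hδ₁
    (not_lt.1 (mt (gauge_lt_one_iff_mem_interior hK hK₀).1 hx))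
  mapsTo x hx := by
    rw [expansion_of_gauge_le_one (gauge_le_one_of_mem hx)]
    exact radialRetraction_mem hK hK₀ hKc _
  interior_subset_image y hy := by
    have hyK : y ∈ K := interior_subset hy
    have hδy : gauge K (δ • y) ≤ 1 := by
      rw [gauge_smul_of_nonneg hδ.le]
      exact mul_le_one₀ hδ₁ (gauge_nonneg _) (gauge_le_one_of_mem hyK)
    refine ⟨δ • y, hU hyK, ?_⟩
    rw [expansion_of_gauge_le_one hδy, inv_smul_smul₀ hδ.ne',
      radialRetraction_of_gauge_le_one (gauge_le_one_of_mem hyK)]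
  disjoint_image_compl := by
    rw [disjoint_right]
    rintro _ ⟨x, hxU, rfl⟩
    rcases le_total (gauge K x) 1 with hx | hx
    · have hδx : δ⁻¹ • x ∉ K := fun h => hxU (by simpa [hδ.ne'] using hU h)
      rw [← hKc.closure_eq, ← gauge_le_one_iff_mem_closure hK hK₀, not_le] at hδx
      rw [expansion_of_gauge_le_one hx]
      exact (radialRetraction_mem_frontier hK hK₀ hδx.le).2
    · rw [expansion_of_one_le_gauge hδ hδ₁ hx, ← gauge_lt_one_iff_mem_interior hK hK₀]
      exact hx.not_gt
  frontier_sdiff_subset_image y hy := by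
    have hyK : y ∈ K := hKc.frontier_subset hy.1
    obtain ⟨_, ⟨t, ht, rfl⟩, htU⟩ := inter_frontier_nonempty_of_isPreconnected
      (isPreconnected_Icc.image (fun t : ℝ => t • y) (by fun_prop) : IsPreconnected (_ '' Icc δ 1))
      ⟨δ • y, ⟨δ, ⟨le_rfl, hδ₁⟩, rfl⟩, hU hyK⟩ ⟨y, ⟨1, ⟨hδ₁, le_rfl⟩, one_smul ℝ y⟩, hy.2⟩
    exact ⟨t • y, htU, expansion_smul_of_mem_frontier hK hK₀ hδ hy.1 ht⟩

lemma exists_isEngulfing_of_mem_nhds_zero (hK : Convex ℝ K) (hK₀ : K ∈ 𝓝 0) (hKc : IsClosed K)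
    (hKb : Bornology.IsBounded K) (hU : U ∈ 𝓝 0) :
    ∃ f : V → V, IsEngulfing f K U ∧ (∃ L, LipschitzWith L f) ∧ ∃ D, ∀ x, ‖f x - x‖ ≤ D := by
  have habsorbs : Absorbs ℝ U K := (NormedSpace.isVonNBounded_iff ℝ).2 hKb hU
  have hsmall : ∀ᶠ δ : ℝ in 𝓝[>] 0, MapsTo (δ • ·) K U :=
    (habsorbs.eventually_nhds_zero (mem_of_mem_nhds hU)).filter_mono nhdsWithin_le_nhds
  obtain ⟨δ, hδU, hδ, hδ₁⟩ := (hsmall.and (Ioc_mem_nhdsGT (zero_lt_one' ℝ))).exists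
  exact ⟨expansion K δ, isEngulfing_expansion hK hK₀ hKc hδ hδ₁ hδU,
    exists_lipschitzWith_expansion hK hK₀ hKb δ, _, norm_expansion_sub_le hK hK₀ hKb hKc δ⟩

theorem exists_isEngulfing (hK : Convex ℝ K) (hKc : IsClosed K) (hKb : Bornology.IsBounded K)
    (hU : IsOpen U) (h : (interior K ∩ U).Nonempty) :
    ∃ f : V → V, IsEngulfing f K U ∧ (∃ L, LipschitzWith L f) ∧ ∃ D, ∀ x, ‖f x - x‖ ≤ D := by
  obtain ⟨a, haK, haU⟩ := h
  let e : V ≃ₜ V := .addLeft a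
  have he₀ : e 0 = a := add_zero a
  obtain ⟨f, hf, ⟨L, hL⟩, D, hD⟩ := exists_isEngulfing_of_mem_nhds_zero (K := e ⁻¹' K)
    (U := e ⁻¹' U) (hK.translate_preimage_right a)
    (e.continuous.continuousAt.preimage_mem_nhds (by rwa [he₀, ← mem_interior_iff_mem_nhds]))
    (hKc.preimage e.continuous) ((isometry_add_left a).antilipschitz.isBounded_preimage hKb)
    ((hU.preimage e.continuous).mem_nhds (by simpa [he₀]))
  refine ⟨e ∘ f ∘ e.symm, ?_, ⟨_, (isometry_add_left a).lipschitz.comp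
    (hL.comp (isometry_add_left (-a)).lipschitz)⟩, D, fun x => ?_⟩
  · simpa only [image_preimage_eq _ e.surjective] using hf.conj e
  · obtain ⟨y, rfl⟩ := e.surjective x
    rw [Function.comp_apply, Function.comp_apply, e.symm_apply_apply]
    simpa [e] using hD y

end Expansion

/-! ### Open partitions of Euclidean space -/

section Dense

lemma interior_eq_empty_of_withDensity_ne_top {X : Type*} [TopologicalSpace X] [MeasurableSpace X]
    [OpensMeasurableSpace X] {μ : Measure X} (hμ : ∀ U, IsOpen U → U.Nonempty → μ U = ∞)
    {g : X → ℝ≥0∞} (hg : Continuous g) (hpos : ∀ x, 0 < g x) {S : Set X}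
    (hS : μ.withDensity g S ≠ ∞) : interior S = ∅ := by
  by_contra! hne
  obtain ⟨x, hx⟩ := hne
  obtain ⟨ε, hε, hεx⟩ := exists_between (hpos x)
  have hU : IsOpen (interior S ∩ g ⁻¹' Ioi ε) := isOpen_interior.inter (isOpen_Ioi.preimage hg)
  refine hS (top_unique ?_)
  calc ∞ = ε * μ (interior S ∩ g ⁻¹' Ioi ε) := by
        rw [hμ _ hU ⟨x, hx, hεx⟩, ENNReal.mul_top hε.ne']
    _ = ∫⁻ _ in interior S ∩ g ⁻¹' Ioi ε, ε ∂μ := (setLIntegral_const _ _).symm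
    _ ≤ ∫⁻ y in interior S ∩ g ⁻¹' Ioi ε, g y ∂μ :=
        setLIntegral_mono' hU.measurableSet fun y hy => hy.2.le
    _ ≤ μ.withDensity g (interior S ∩ g ⁻¹' Ioi ε) := withDensity_apply_le _ _
    _ ≤ μ.withDensity g S := measure_mono (inter_subset_left.trans interior_subset)

lemma exists_hausdorff_eq_smul (n m : ℕ) :
    ∃ κ : ℝ≥0, 0 < κ ∧ hausdorff n m = κ • (μH[(n : ℝ)] : Measure (Euc m)) := by
  have hpos : volume (Metric.ball (0 : Euc n) 1) / 2 ^ n ≠ 0 :=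
    (ENNReal.div_pos (Metric.measure_ball_pos _ _ one_pos).ne' (by finiteness)).ne'
  have htop : volume (Metric.ball (0 : Euc n) 1) / 2 ^ n ≠ ∞ :=
    ENNReal.div_ne_top measure_ball_lt_top.ne (by positivity)
  exact ⟨_, ENNReal.toNNReal_pos hpos htop, by
    rw [hausdorff, ENNReal.smul_def, ENNReal.coe_toNNReal htop]⟩

lemma exists_volume_eq_smul (n : ℕ) :
    ∃ a : ℝ≥0, (volume : Measure (Euc (n + 1))) = a • μH[(n : ℝ) + 1] :=
  have := isAddHaarMeasure_hausdorffMeasure_add_one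
    (V := Euc (n + 1)) finrank_euclideanSpace_fin
  ⟨_, Measure.isAddLeftInvariant_eq_smul _ _⟩

lemma hausdorff_eq_top_of_isOpen {n : ℕ} {U : Set (Euc (n + 1))} (hU : IsOpen U)
    (hne : U.Nonempty) : hausdorff n (n + 1) U = ∞ := by
  have := isAddHaarMeasure_hausdorffMeasure_add_one
    (V := Euc (n + 1)) finrank_euclideanSpace_fin
  have hpos : μH[(n : ℝ) + 1] U ≠ 0 := (hU.measure_pos _ hne).ne'
  have htop : μH[(n : ℝ)] U = ∞ :=
    (Measure.hausdorffMeasure_zero_or_top (lt_add_one _) U).resolve_left hpos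
  obtain ⟨κ, hκ, h⟩ := exists_hausdorff_eq_smul n (n + 1)
  rw [h, Measure.smul_apply, htop, ENNReal.smul_top, if_neg hκ.ne']

lemma IsOpenPartition.dense {n N : ℕ} {Ω : Euc (n + 1) → ℝ} {E : Fin N → Set (Euc (n + 1))}
    (hE : IsOpenPartition Ω E) (hΩ : IsWeight Ω) : Dense (⋃ i, E i) := by
  rw [← compl_compl (⋃ i, E i), ← interior_eq_empty_iff_dense_compl]
  exact interior_eq_empty_of_withDensity_ne_top (fun U => hausdorff_eq_top_of_isOpen)
    (ENNReal.continuous_ofReal.comp hΩ.1.continuous)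
    (fun x => ENNReal.ofReal_pos.2 (hΩ.2.1 x).1) hE.finite.ne

end Dense

section Admissible

variable {n N : ℕ}

lemma bdryMeasure_apply {E : Fin N → Set (Euc (n + 1))} (hE : ∀ i, IsOpen (E i))
    (hd : Pairwise (Disjoint on E)) (hdense : Dense (⋃ i, E i)) {S : Set (Euc (n + 1))}
    (hS : MeasurableSet S) : bdryMeasure E S = hausdorff n (n + 1) (S \ ⋃ i, E i) := by
  rw [bdryMeasure, Measure.restrict_apply hS, bdry, iUnion_frontier_eq_compl hE hd hdense,
    sdiff_eq]

lemma le_rpow_div_of_pow_le_pow {a b : ℝ≥0∞} {k l : ℕ} (hk : k ≠ 0) (h : a ^ k ≤ b ^ l) :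
    a ≤ b ^ ((l : ℝ) / k) := by
  rwa [← ENNReal.pow_le_pow_left_iff hk, ← ENNReal.rpow_mul_natCast,
    div_mul_cancel₀ _ (Nat.cast_ne_zero.2 hk), ENNReal.rpow_natCast]

lemma exists_volume_le_of_hausdorffMeasure_pow_le (hn : n ≠ 0) (C : ℝ≥0) :
    ∃ C' : ℝ, 0 < C' ∧ ∀ S T : Set (Euc (n + 1)),
      μH[(n : ℝ) + 1] S ^ n ≤ (C * μH[n] T) ^ (n + 1) →
        volume S ≤ ENNReal.ofReal C' * hausdorff n (n + 1) T ^ (((n : ℝ) + 1) / n) := by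
  obtain ⟨κ, hκ, hhausdorff⟩ := exists_hausdorff_eq_smul n (n + 1)
  obtain ⟨a, hvolume⟩ := exists_volume_eq_smul n
  have hp : 0 ≤ ((n : ℝ) + 1) / n := by positivity
  refine ⟨a * (C / κ) ^ (((n : ℝ) + 1) / n) + 1, by positivity, fun S T h => ?_⟩
  have hroot : μH[(n : ℝ) + 1] S ≤ (C * μH[n] T) ^ (((n : ℝ) + 1) / n) := by
    simpa only [Nat.cast_add_one] using le_rpow_div_of_pow_le_pow hn h
  have hscale : (C : ℝ≥0∞) * μH[n] T = ↑(C / κ) * hausdorff n (n + 1) T := by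
    rw [hhausdorff, Measure.smul_apply, ENNReal.smul_def, smul_eq_mul, ← mul_assoc,
      ← ENNReal.coe_mul, div_mul_cancel₀ C hκ.ne']
  calc volume S = a * μH[(n : ℝ) + 1] S := by
        rw [hvolume, Measure.smul_apply, ENNReal.smul_def, smul_eq_mul]
    _ ≤ a * (↑(C / κ) * hausdorff n (n + 1) T) ^ (((n : ℝ) + 1) / n) := by
        rw [← hscale]
        gcongr
    _ = ENNReal.ofReal (a * (C / κ) ^ (((n : ℝ) + 1) / n)) *
          hausdorff n (n + 1) T ^ (((n : ℝ) + 1) / n) := by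
        rw [ENNReal.mul_rpow_of_nonneg _ _ hp, ← mul_assoc, ENNReal.ofReal_mul (by positivity),
          ← ENNReal.ofReal_rpow_of_nonneg (by positivity) hp, ← NNReal.coe_div,
          ENNReal.ofReal_coe_nnreal, ENNReal.ofReal_coe_nnreal]
    _ ≤ ENNReal.ofReal (a * (C / κ) ^ (((n : ℝ) + 1) / n) + 1) *
          hausdorff n (n + 1) T ^ (((n : ℝ) + 1) / n) := by
        gcongr
        exact le_add_of_nonneg_right zero_le_one

theorem exists_dominant_cell_bdryMeasure (hn : 1 ≤ n) :
    ∃ c C : ℝ, 0 < c ∧ 0 < C ∧ ∀ (N : ℕ) (E : Fin N → Set (Euc (n + 1))), (∀ i, IsOpen (E i)) →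
      Pairwise (Disjoint on E) → Dense (⋃ i, E i) → ∀ R, 0 < R →
      bdryMeasure E (Metric.closedBall 0 R) ≤ ENNReal.ofReal (c * R ^ n) →
      ∃ i, ∃ r ∈ Icc (R / 2) R, (Metric.ball 0 r ∩ E i).Nonempty ∧
        hausdorff n (n + 1) (Metric.sphere 0 r \ E i) ≤
          1 / 2 * bdryMeasure E (Metric.closedBall 0 r) ∧
        volume (Metric.closedBall 0 r \ E i) ≤
          ENNReal.ofReal C * bdryMeasure E (Metric.closedBall 0 r) ^ (((n : ℝ) + 1) / n) := by
  obtain ⟨c, C, hc, hcell⟩ := exists_dominant_cell (V := Euc (n + 1)) hn finrank_euclideanSpace_fin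
  obtain ⟨C', hC', hvolume⟩ := exists_volume_le_of_hausdorffMeasure_pow_le (n := n) (by lia) C
  obtain ⟨κ, hκ, hhausdorff⟩ := exists_hausdorff_eq_smul n (n + 1)
  have hκS (S : Set (Euc (n + 1))) : hausdorff n (n + 1) S = κ * μH[n] S := by
    rw [hhausdorff, Measure.smul_apply, ENNReal.smul_def, smul_eq_mul]
  refine ⟨κ * c, C', by positivity, hC', fun N E hE hd hdense R hR hsmall => ?_⟩
  simp only [bdryMeasure_apply hE hd hdense measurableSet_closedBall] at hsmall ⊢
  have : Nonempty (Fin N) := (nonempty_iUnion.1 hdense.nonempty).nonempty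
  have hsmall' : μH[n] (Metric.closedBall (0 : Euc (n + 1)) R \ ⋃ i, E i) ≤
      c * ENNReal.ofReal R ^ n := by
    rw [hκS, ENNReal.ofReal_mul (by positivity), ENNReal.ofReal_mul (by positivity),
      ENNReal.ofReal_coe_nnreal, ENNReal.ofReal_coe_nnreal, ENNReal.ofReal_pow hR.le,
      mul_assoc] at hsmall
    exact (ENNReal.mul_le_mul_iff_right (by exact_mod_cast hκ.ne') ENNReal.coe_ne_top).1 hsmall
  obtain ⟨i, r, hr, hne, hsphere, hball⟩ := hcell (Fin N) E hE hd R hR hsmall'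
  refine ⟨i, r, hr, hne, ?_, hvolume _ _ hball⟩
  rw [hκS, hκS, mul_left_comm, one_div, mul_comm 2⁻¹, ← div_eq_mul_inv]
  exact mul_le_mul_right hsphere _

lemma IsEngulfing.isAdmissible {m : ℕ} {E : Fin N → Set (Euc m)} {f : Euc m → Euc m}
    {K : Set (Euc m)} {i₀ : Fin N} (h : IsEngulfing f K (E i₀)) (hK : K ⊆ closure (interior K))
    (hKc : IsClosed K) (hE : ∀ i, IsOpen (E i)) (hd : Pairwise (Disjoint on E))
    (hdense : Dense (⋃ i, E i)) (hL : ∃ L, LipschitzWith L f) (hD : ∃ D, ∀ x, ‖f x - x‖ ≤ D) :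
    IsAdmissible E f where
  lipschitz := hL
  disjoint _ _ hij := h.pairwise_disjoint_interior_image hK hd hij
  compl_subset := h.compl_iUnion_interior_image_subset hKc hE
    (iUnion_frontier_eq_compl hE hd hdense).ge
  displacement := hD

end Admissible

end OpenPartition

theorem proposition7p2_general (n : ℕ) (hn : 1 ≤ n) :
    ∃ c₂ c₃ : ℝ, 0 < c₂ ∧ 0 < c₃ ∧
      ∀ (N : ℕ) (E : Fin N → Set (Euc (n + 1))), (∀ i, IsOpen (E i)) →
        (∀ i j, i ≠ j → Disjoint (E i) (E j)) → Dense (⋃ i, E i) →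
      ∀ R : ℝ, 0 < R →
        bdryMeasure E (Metric.closedBall 0 R) ≤ ENNReal.ofReal (c₂ * R ^ n) →
        ∃ (f : Euc (n + 1) → Euc (n + 1)) (r : ℝ),
          IsAdmissible E f ∧ r ∈ Set.Icc (R / 2) R ∧
          (∀ x, x ∉ Metric.ball (0 : Euc (n + 1)) r → f x = x) ∧
          (∀ x ∈ Metric.closedBall (0 : Euc (n + 1)) r, f x ∈ Metric.closedBall 0 r) ∧
          bdryMeasure (push f E) (Metric.closedBall 0 r) ≤
            (1 / 2 : ℝ≥0∞) * bdryMeasure E (Metric.closedBall 0 r) ∧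
          ∀ i, volume (symmDiff (E i) (push f E i)) ≤
            ENNReal.ofReal c₃ *
              bdryMeasure E (Metric.closedBall 0 r) ^ (((n : ℝ) + 1) / (n : ℝ)) := by
  obtain ⟨c, C, hc, hC, hcell⟩ := exists_dominant_cell_bdryMeasure hn
  refine ⟨c, C, hc, hC, fun N E hE hd hdense R hR hsmall => ?_⟩
  obtain ⟨i₀, r, hr, hne, hsphere, hball⟩ := hcell N E hE hd hdense R hR hsmall
  have hr₀ : r ≠ 0 := by linarith [hr.1]
  have hint : interior (Metric.closedBall (0 : Euc (n + 1)) r) = Metric.ball 0 r :=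
    interior_closedBall 0 hr₀
  have hK : Metric.closedBall (0 : Euc (n + 1)) r ⊆ closure (interior (Metric.closedBall 0 r)) := by
    rw [hint, closure_ball 0 hr₀]
  obtain ⟨f, hf, hL, hD⟩ := exists_isEngulfing (convex_closedBall 0 r) Metric.isClosed_closedBall
    Metric.isBounded_closedBall (hE i₀) (hint ▸ hne)
  refine ⟨f, r, hf.isAdmissible hK Metric.isClosed_closedBall hE hd hdense hL hD, hr,
    fun x hx => hf.eqOn_id (hint ▸ hx), hf.mapsTo, ?_, fun i => ?_⟩
  · rw [bdryMeasure, Measure.restrict_apply measurableSet_closedBall, inter_comm]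
    have hfrontier := hf.iUnion_frontier_interior_image_inter_subset hK hE hd
    rw [frontier_closedBall 0 hr₀] at hfrontier
    exact (measure_mono hfrontier).trans hsphere
  · exact (measure_mono
      (hf.symmDiff_interior_image_subset Metric.isClosed_closedBall hK hE hd i)).trans hball

theorem proposition7p2 (n : ℕ) (hn : 1 ≤ n) :
    ∃ c₂ c₃ : ℝ, 0 < c₂ ∧ 0 < c₃ ∧
      ∀ (Ω : Euc (n + 1) → ℝ), IsWeight Ω →
      ∀ (N : ℕ) (E : Fin N → Set (Euc (n + 1))), IsOpenPartition Ω E →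
      ∀ R : ℝ, 0 < R →
        (0 : Euc (n + 1)) ∈ (bdryMeasure E).support →
        bdryMeasure E (Metric.closedBall 0 R) ≤ ENNReal.ofReal (c₂ * R ^ n) →
        ∃ (f : Euc (n + 1) → Euc (n + 1)) (r : ℝ),
          IsAdmissible E f ∧ r ∈ Set.Icc (R / 2) R ∧
          (∀ x, x ∉ Metric.ball (0 : Euc (n + 1)) r → f x = x) ∧
          (∀ x ∈ Metric.closedBall (0 : Euc (n + 1)) r, f x ∈ Metric.closedBall 0 r) ∧
          bdryMeasure (push f E) (Metric.closedBall 0 r) ≤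
            (1 / 2 : ℝ≥0∞) * bdryMeasure E (Metric.closedBall 0 r) ∧
          ∀ i, volume (symmDiff (E i) (push f E i)) ≤
            ENNReal.ofReal c₃ *
              bdryMeasure E (Metric.closedBall 0 r) ^ (((n : ℝ) + 1) / (n : ℝ)) := by
  obtain ⟨c₂, c₃, hc₂, hc₃, h⟩ := proposition7p2_general n hn
  exact ⟨c₂, c₃, hc₂, hc₃, fun Ω hΩ N E hE R hR _ =>
    h N E hE.isOpen hE.disjoint (hE.dense hΩ) R hR⟩
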